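/- Let $X$, $Y$, $\partial X$ be (real or complex) Banach spaces with $Y\hookrightarrow X$ continuously. Let $A:D(A)\to X$ be linear with $D(A)\subset Y$, let $R:D(A)\to\partial X$ be linear, and let $B_1,B_2\in\mathcal L(Y,\partial X)$, $B_3,B_4\in\mathcal L(\partial X)$. Assume that $\binom{A}{R}:D(A)\subset Y\to X\times\partial X$ is closed. Let $M:D(M)\subset\partial X\to\partial X$ be a closed linear operator with $1\in\rho(M)$, and put $R(1,M):=(1-M)^{-1}$, $L:=R+B_2$, $B_i^\diamond:=R(1,M)B_i$ for $i=1,2,3,4$, and $R^\diamond:=L-B_2^\diamond$ on $D(A)$. Assume that - $R^\diamond:D(A)\to\partial X$ is surjective, and - the restriction $A_0^\diamond:=A|_{\ker R^\diamond}$ generates a cosine operator function on $X$ with associated phase space $Y\times X$; here "with associated phase space $Y\times X$" means that the matrix $\begin{pmatrix}0&I_Y\\A_0^\diamond&0\end{pmatrix}$ with domain $D(A_0^\diamond)\times Y$ generates a strongly continuous semigroup on $Y\times X$. Then the problem $$\begin{cases}\ddot u(t)=Au(t),& t\in\mathbb R,\\ \ddot x(t)=B_1^\diamond u(t)+B_2^\diamond\dot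 u(t)+B_3^\diamond x(t)+B_4^\diamond\dot x(t),& t\in\mathbb R,\\ \dot x(t)=Lu(t),& t\in\mathbb R,\\ u(0)=f,\ \dot u(0)=g,\quad x(0)=h,\ \dot x(0)=j\end{cases}\tag{AIBVP$_2^\diamond$}$$ is well-posed in the following sense. A classical solution is a pair $(u,x)$ with $u\in C^2(\mathbb R,X)\cap C^1(\mathbb R,Y)$, $u(t)\in D(A)$ for all $t\in\mathbb R$, $Lu\in C^1(\mathbb R,\partial X)$, satisfying (AIBVP$_2^\diamond$) pointwise. 1. The set of compatible initial data $\{(f,g,h,j): f\in D(A),\ g\in Y,\ h,j\in\partial X,\ Lf=j\}$ is dense in $Y\times X\times\partial X\times\partial X$. 2. For all compatible initial data there is exactly one classical solution. 3. For every $\tau\ge 0$ there is a constant $K$ such that every classical solution satisfies, for all $|t|\le\tau$, $$\|u(t)\|_Y+\|\dot u(t)\|_X+\|x(t)\|_{\partial X}+\|\dot x(t)\|_{\partial X}\le K\left(\|f\|_Y+\|g\|_X+\|h\|_{\partial X}+\|j\|_{\partial X}\right).$$ -/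

import Mathlib

open Filter Topology
open scoped NNReal

noncomputable section

/-- A strongly continuous one-parameter semigroup of bounded linear operators on `E`. -/
structure C0Semigroup (𝕜 E : Type*) [RCLike 𝕜] [NormedAddCommGroup E] [NormedSpace 𝕜 E] where
  op : ℝ≥0 → E →L[𝕜] E
  op_zero : op 0 = ContinuousLinearMap.id 𝕜 E
  op_add : ∀ s t : ℝ≥0, op (s + t) = (op s).comp (op t)
  continuous_orbit : ∀ x : E, Continuous fun t : ℝ≥0 => op t x

/-- The graph of the generator of a strongly continuous semigroup `T`: all `(x, y)` such that
`y = lim_{t → 0+} (T(t) x - x) / t`. -/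
def C0Semigroup.generatorGraph {𝕜 E : Type*} [RCLike 𝕜] [NormedAddCommGroup E] [NormedSpace 𝕜 E]
    [NormedSpace ℝ E] (T : C0Semigroup 𝕜 E) : Set (E × E) :=
  {p | Tendsto (fun t : ℝ≥0 => (t : ℝ)⁻¹ • (T.op t p.1 - p.1)) (𝓝[>] 0) (𝓝 p.2)}

/-- A (strongly continuous) cosine operator function on `X`: a strongly continuous solution of
d'Alembert's functional equation `C(t + s) + C(t - s) = 2 C(t) C(s)` with `C(0) = I`. -/
structure CosineFunction (𝕜 X : Type*) [RCLike 𝕜] [NormedAddCommGroup X] [NormedSpace 𝕜 X] where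
  op : ℝ → X →L[𝕜] X
  op_zero : op 0 = ContinuousLinearMap.id 𝕜 X
  dAlembert : ∀ t s : ℝ, op (t + s) + op (t - s) = (2 : 𝕜) • (op t).comp (op s)
  continuous_orbit : ∀ x : X, Continuous fun t : ℝ => op t x

/-- The graph of the generator of a cosine operator function `C`: all `(x, y)` such that
`y = lim_{t → 0} 2 (C(t) x - x) / t ^ 2`. -/
def CosineFunction.generatorGraph {𝕜 X : Type*} [RCLike 𝕜] [NormedAddCommGroup X]
    [NormedSpace 𝕜 X] [NormedSpace ℝ X] (C : CosineFunction 𝕜 X) : Set (X × X) :=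
  {p | Tendsto (fun t : ℝ => (2 / t ^ 2 : ℝ) • (C.op t p.1 - p.1)) (𝓝[≠] 0) (𝓝 p.2)}

/-- Let `ι : Y → X` be the embedding of `Y` into `X` and let `A : D(A) ⊆ Y → X`. This is the graph
of `A` as an (unbounded) operator on `X`. -/
def graphIn {𝕜 X Y : Type*} [RCLike 𝕜] [NormedAddCommGroup X] [NormedSpace 𝕜 X]
    [NormedAddCommGroup Y] [NormedSpace 𝕜 Y] (ι : Y →L[𝕜] X) (A : Y →ₗ.[𝕜] X) : Set (X × X) :=
  {p | ∃ u : A.domain, p.1 = ι u ∧ p.2 = A u}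

/-- The graph of the operator matrix with rows `(0, I_Y)` and `(A, 0)` on `Y × X`, whose domain is
`D(A) × Y`; that is, the set of all `((u, v), (v, A u))` with `u ∈ D(A)` and `v ∈ Y`. -/
def reductionGraph {𝕜 X Y : Type*} [RCLike 𝕜] [NormedAddCommGroup X] [NormedSpace 𝕜 X]
    [NormedAddCommGroup Y] [NormedSpace 𝕜 Y] (ι : Y →L[𝕜] X) (A : Y →ₗ.[𝕜] X) :
    Set ((Y × X) × (Y × X)) :=
  {p | ∃ (u : A.domain) (v : Y), p = (((u : Y), ι v), (v, A u))}

/-- `A` generates a cosine operator function on `X` with associated phase space `Y × X`.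
As usual, the phase space of a cosine function with generator `A` is the product `Y × X`, where `Y`
is the (unique up to equivalent norms) Banach space with `D(A) ⊆ Y ↪ X` such that the matrix with
rows `(0, I_Y)` and `(A, 0)` and domain `D(A) × Y` generates a strongly continuous semigroup
on `Y × X`. -/
def GeneratesCosineWithPhaseSpace {𝕜 X Y : Type*} [RCLike 𝕜]
    [NormedAddCommGroup X] [NormedSpace 𝕜 X] [NormedSpace ℝ X]
    [NormedAddCommGroup Y] [NormedSpace 𝕜 Y] [NormedSpace ℝ Y]
    (ι : Y →L[𝕜] X) (A : Y →ₗ.[𝕜] X) : Prop :=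
  (∃ C : CosineFunction 𝕜 X, C.generatorGraph = graphIn ι A) ∧
    ∃ T : C0Semigroup 𝕜 (Y × X), T.generatorGraph = reductionGraph ι A

/-- `S` is the bounded inverse of `l - M : D(M) → Z`. -/
def IsResolventAt {𝕜 Z : Type*} [RCLike 𝕜] [NormedAddCommGroup Z] [NormedSpace 𝕜 Z]
    (M : Z →ₗ.[𝕜] Z) (l : 𝕜) (S : Z →L[𝕜] Z) : Prop :=
  (∀ z : Z, ∃ w : M.domain, (w : Z) = S z ∧ l • (w : Z) - M w = z) ∧
    ∀ w : M.domain, S (l • (w : Z) - M w) = w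

/-- The resolvent set `ρ(M)`. -/
def resolventSetOf {𝕜 Z : Type*} [RCLike 𝕜] [NormedAddCommGroup Z] [NormedSpace 𝕜 Z]
    (M : Z →ₗ.[𝕜] Z) : Set 𝕜 :=
  {l | ∃ S : Z →L[𝕜] Z, IsResolventAt M l S}

open Classical in
/-- The resolvent operator `R(l, M) = (l - M)⁻¹` for `l ∈ ρ(M)` (and `0` otherwise). -/
def resolventOf {𝕜 Z : Type*} [RCLike 𝕜] [NormedAddCommGroup Z] [NormedSpace 𝕜 Z]
    (M : Z →ₗ.[𝕜] Z) (l : 𝕜) : Z →L[𝕜] Z :=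
  if h : ∃ S : Z →L[𝕜] Z, IsResolventAt M l S then h.choose else 0

/-- The restriction `A|_{ker R}` of `A` to the kernel of `R : D(A) → Z`. -/
def restrictKer {𝕜 X Y Z : Type*} [RCLike 𝕜] [NormedAddCommGroup X] [NormedSpace 𝕜 X]
    [NormedAddCommGroup Y] [NormedSpace 𝕜 Y] [NormedAddCommGroup Z] [NormedSpace 𝕜 Z]
    (A : Y →ₗ.[𝕜] X) (R : A.domain →ₗ[𝕜] Z) : Y →ₗ.[𝕜] X :=
  A.domRestrict ((LinearMap.ker R).map A.domain.subtype)

/-- `B : Y → Z` restricted to `D(A) ⊆ Y`. -/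
def restrictDomain {𝕜 X Y Z : Type*} [RCLike 𝕜] [NormedAddCommGroup X] [NormedSpace 𝕜 X]
    [NormedAddCommGroup Y] [NormedSpace 𝕜 Y] [NormedAddCommGroup Z] [NormedSpace 𝕜 Z]
    (A : Y →ₗ.[𝕜] X) (B : Y →L[𝕜] Z) : A.domain →ₗ[𝕜] Z :=
  (B : Y →ₗ[𝕜] Z) ∘ₗ A.domain.subtype

/-- The stacked operator `u ↦ (A u, R u)`, `D(A) ⊆ Y → X × Z`. -/
def stacked {𝕜 X Y Z : Type*} [RCLike 𝕜] [NormedAddCommGroup X] [NormedSpace 𝕜 X]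
    [NormedAddCommGroup Y] [NormedSpace 𝕜 Y] [NormedAddCommGroup Z] [NormedSpace 𝕜 Z]
    (A : Y →ₗ.[𝕜] X) (R : A.domain →ₗ[𝕜] Z) : Y →ₗ.[𝕜] X × Z :=
  ⟨A.domain, A.toFun.prod R⟩

/-- `u` is a classical solution, with boundary function `x`, of the problem on `ℝ`
`u'' = A u`, `x'' = B₁ u + B₂ u' + B₃ x + B₄ x'`, `x' = L u`,
`u(0) = f`, `u'(0) = g`, `x(0) = h`, `x'(0) = j`.
A function with values in `D(A) ⊆ Y` is regarded as a function with values in `Y`, and through the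
embedding `ι : Y → X` as a function with values in `X`. -/
structure IsClassicalSolution {𝕜 X Y Z : Type*} [RCLike 𝕜]
    [NormedAddCommGroup X] [NormedSpace 𝕜 X] [NormedSpace ℝ X]
    [NormedAddCommGroup Y] [NormedSpace 𝕜 Y] [NormedSpace ℝ Y]
    [NormedAddCommGroup Z] [NormedSpace 𝕜 Z] [NormedSpace ℝ Z]
    (ι : Y →L[𝕜] X) (A : Y →ₗ.[𝕜] X) (L : A.domain →ₗ[𝕜] Z)
    (B₁ B₂ : Y →L[𝕜] Z) (B₃ B₄ : Z →L[𝕜] Z) (f g : Y) (h j : Z)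
    (u : ℝ → A.domain) (x : ℝ → Z) : Prop where
  contDiff_X : ContDiff ℝ 2 fun t => ι (u t)
  contDiff_Y : ContDiff ℝ 1 fun t => (u t : Y)
  contDiff_L : ContDiff ℝ 1 fun t => L (u t)
  interior_eq : ∀ t, deriv (deriv fun s => ι (u s)) t = A (u t)
  boundary_eq : ∀ t, deriv (deriv x) t =
    B₁ (u t) + B₂ (deriv (fun s => (u s : Y)) t) + B₃ (x t) + B₄ (deriv x t)
  coupling_eq : ∀ t, HasDerivAt x (L (u t)) t
  init_u : (u 0 : Y) = f
  init_u' : deriv (fun s => (u s : Y)) 0 = g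
  init_x : x 0 = h
  init_x' : deriv x 0 = j

/-- Well-posedness of the above problem: the compatible initial data
(`f ∈ D(A)`, `g ∈ Y`, `h, j ∈ Z`, `L f = j`) are dense in `Y × X × Z × Z`, each of them admits
a unique classical solution on `ℝ`, and the state `(u, u', x, x')` depends continuously on the
initial data in the norm of `Y × X × Z × Z`, uniformly on compact time intervals. -/
structure IsWellPosed {𝕜 X Y Z : Type*} [RCLike 𝕜]
    [NormedAddCommGroup X] [NormedSpace 𝕜 X] [NormedSpace ℝ X]
    [NormedAddCommGroup Y] [NormedSpace 𝕜 Y] [NormedSpace ℝ Y]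
    [NormedAddCommGroup Z] [NormedSpace 𝕜 Z] [NormedSpace ℝ Z]
    (ι : Y →L[𝕜] X) (A : Y →ₗ.[𝕜] X) (L : A.domain →ₗ[𝕜] Z)
    (B₁ B₂ : Y →L[𝕜] Z) (B₃ B₄ : Z →L[𝕜] Z) : Prop where
  dense_data : Dense {p : Y × X × Z × Z |
    ∃ (f : A.domain) (g : Y) (h : Z), p = ((f : Y), ι g, h, L f)}
  existsUnique : ∀ (f : A.domain) (g : Y) (h j : Z), L f = j →
    ∃! p : (ℝ → A.domain) × (ℝ → Z),
      IsClassicalSolution ι A L B₁ B₂ B₃ B₄ (f : Y) g h j p.1 p.2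
  continuous_dependence : ∀ τ : ℝ, ∃ K : ℝ, ∀ (f g : Y) (h j : Z) (u : ℝ → A.domain) (x : ℝ → Z),
    IsClassicalSolution ι A L B₁ B₂ B₃ B₄ f g h j u x → ∀ t : ℝ, |t| ≤ τ →
      ‖(u t : Y)‖ + ‖deriv (fun s => ι (u s)) t‖ + ‖x t‖ + ‖deriv x t‖ ≤
        K * (‖f‖ + ‖ι g‖ + ‖h‖ + ‖j‖)

end

/-! Put `y = R' u = L u - B₂◇ u`. Along a classical solution `(L u)' = x'' = B₁◇ u + B₂◇ u' + B₃◇ x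
+ B₄◇ x'`, so the terms in `u'` cancel and `y' = B₁◇ u + B₃◇ x + B₄◇ L u`. The boundary condition
thus becomes an ordinary differential equation with bounded coefficients.

The constraint `R' u = y` is removed by a Dirichlet operator `D`, a bounded right inverse of `R'`
with `A D = μ D` (`exists_dirichlet`). Then `w = u - D y` lies in `ker R'`, and with `v = u'` one
has `w' = v - D y'` and `v' = A w + μ D y`. In the coordinates `((w, v), (x, y))` the problem is
therefore a bounded perturbation of the reduction matrix on `ker R'`, extended by zero to the two
boundary components (`exists_state_group`).

Two facts of semigroup theory carry this. The reduction matrix changes sign under `(u, v) ↦ (u,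
-v)`, so its semigroup extends to a group (`C0Semigroup.exists_group`), which gives solutions for
negative times. Bounded perturbations of group generators generate groups with the same domain
(`C0Group.exists_perturbation`).

Classical solutions correspond exactly to orbits starting in the domain of the perturbed generator.
Existence, uniqueness and the estimate are then properties of the group, and density of the
compatible data is density of that domain. -/

noncomputable section

/-! ### Strongly continuous operator families -/

section PointwiseContinuity

variable {𝕜 α E F : Type*} [RCLike 𝕜] [NormedAddCommGroup E] [NormedSpace 𝕜 E] [CompleteSpace E]
  [NormedAddCommGroup F] [NormedSpace 𝕜 F] [TopologicalSpace α]

/-- A strongly continuous family of operators on a Banach space is bounded on compact sets. -/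
theorem exists_norm_le_of_isCompact {a : α → E →L[𝕜] F} (ha : ∀ x, Continuous fun t => a t x)
    {K : Set α} (hK : IsCompact K) : ∃ C, 0 ≤ C ∧ ∀ t ∈ K, ‖a t‖ ≤ C := by
  have h : ∀ x, ∃ C, ∀ t : K, ‖a t x‖ ≤ C := by
    intro x
    obtain ⟨C, hC⟩ := hK.exists_bound_of_continuousOn (ha x).continuousOn
    exact ⟨C, fun t => hC t t.2⟩
  obtain ⟨C, hC⟩ := banach_steinhaus h
  exact ⟨max C 0, le_max_right _ _, fun t ht => (hC ⟨t, ht⟩).trans (le_max_left _ _)⟩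

/-- A strongly continuous family of operators on a Banach space acts jointly continuously. -/
theorem continuous_uncurry_of_pointwise [WeaklyLocallyCompactSpace α] {a : α → E →L[𝕜] F}
    (ha : ∀ x, Continuous fun t => a t x) : Continuous fun p : α × E => a p.1 p.2 := by
  rw [continuous_iff_continuousAt]
  rintro ⟨t, x⟩
  obtain ⟨K, hK, hKt⟩ := exists_compact_mem_nhds t
  obtain ⟨C, hC0, hC⟩ := exists_norm_le_of_isCompact ha hK
  have h1 : Tendsto (fun p : α × E => C * ‖p.2 - x‖ + ‖a p.1 x - a t x‖) (𝓝 (t, x)) (𝓝 0) := by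
    have : Continuous (fun p : α × E => C * ‖p.2 - x‖ + ‖a p.1 x - a t x‖) := by
      have := (ha x).comp (continuous_fst (X := α) (Y := E))
      simp only [Function.comp_def] at this
      fun_prop
    simpa using this.tendsto (t, x)
  rw [ContinuousAt, tendsto_iff_norm_sub_tendsto_zero]
  refine squeeze_zero' (Eventually.of_forall fun _ => norm_nonneg _) ?_ h1
  have hev : ∀ᶠ p : α × E in 𝓝 (t, x), p.1 ∈ K := continuous_fst.continuousAt.eventually hKt
  filter_upwards [hev] with p hp
  have : a p.1 p.2 - a t x = a p.1 (p.2 - x) + (a p.1 x - a t x) := by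
    rw [map_sub]; abel
  rw [this]
  refine (norm_add_le _ _).trans ?_
  gcongr
  exact (a p.1).le_of_opNorm_le (hC _ hp) _

end PointwiseContinuity

/-! ### Strongly continuous groups and the abstract Cauchy problem -/

/-- A strongly continuous one-parameter group of bounded linear operators on `E`. -/
structure C0Group (𝕜 E : Type*) [RCLike 𝕜] [NormedAddCommGroup E] [NormedSpace 𝕜 E] where
  op : ℝ → E →L[𝕜] E
  op_zero : op 0 = ContinuousLinearMap.id 𝕜 E
  op_add : ∀ s t : ℝ, op (s + t) = (op s).comp (op t)
  continuous_orbit : ∀ x : E, Continuous fun t : ℝ => op t x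

namespace C0Group

variable {𝕜 E : Type*} [RCLike 𝕜] [NormedAddCommGroup E] [NormedSpace 𝕜 E] (G : C0Group 𝕜 E)

@[simp] theorem op_zero_apply (x : E) : G.op 0 x = x := by simp [G.op_zero]

theorem op_add_apply (s t : ℝ) (x : E) : G.op (s + t) x = G.op s (G.op t x) := by
  simp [G.op_add]

@[simp] theorem op_neg_apply (t : ℝ) (x : E) : G.op (-t) (G.op t x) = x := by
  simp [← op_add_apply]

@[simp] theorem op_apply_neg (t : ℝ) (x : E) : G.op t (G.op (-t) x) = x := by
  simp [← op_add_apply]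

theorem continuous_uncurry [CompleteSpace E] : Continuous fun p : ℝ × E => G.op p.1 p.2 :=
  continuous_uncurry_of_pointwise G.continuous_orbit

theorem continuous_op_comp [CompleteSpace E] {β : Type*} [TopologicalSpace β] {τ : β → ℝ}
    {f : β → E} (hτ : Continuous τ) (hf : Continuous f) :
    Continuous fun b => G.op (τ b) (f b) :=
  G.continuous_uncurry.comp (hτ.prodMk hf)

/-- A strongly continuous group is exponentially bounded. -/
theorem exists_norm_le_exp [CompleteSpace E] :
    ∃ c : ℝ, 0 ≤ c ∧ ∀ t, ‖G.op t‖ ≤ Real.exp c * Real.exp (c * |t|) := by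
  obtain ⟨c, hc0, hc⟩ := exists_norm_le_of_isCompact G.continuous_orbit
    (isCompact_Icc (a := (-1 : ℝ)) (b := 1))
  -- A time with `|t| ≤ n + 1` splits off `t / (n + 1)`, of size at most `1`, and leaves a remainder
  -- of size at most `n`. One such piece costs `c ≤ exp c`. Rounding `|t|` up to an integer produces
  -- the prefactor `exp c`.
  have key : ∀ (n : ℕ) (t : ℝ), |t| ≤ n → ‖G.op t‖ ≤ Real.exp (n * c) := by
    intro n
    induction n with
    | zero =>
      intro t ht
      have : t = 0 := by simpa using ht
      subst this
      simpa [G.op_zero] using ContinuousLinearMap.norm_id_le (𝕜 := 𝕜) (E := E)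
    | succ n ih =>
      intro t ht
      push_cast at ht ⊢
      have hn : (0 : ℝ) < n + 1 := by positivity
      have e : t = t / (n + 1) + t * (n / (n + 1)) := by field_simp; ring
      have h1 : |t / (n + 1)| ≤ 1 := by
        rw [abs_div, abs_of_pos hn, div_le_one hn]; exact ht
      have h2 : |t * (n / (n + 1))| ≤ n := by
        rw [abs_mul, abs_of_nonneg (a := (n : ℝ) / (n + 1)) (by positivity)]
        calc |t| * (n / (n + 1)) ≤ (n + 1) * (n / (n + 1)) := by gcongr
          _ = n := by field_simp
      rw [e, G.op_add]
      calc _ ≤ ‖G.op (t / (n + 1))‖ * ‖G.op (t * (n / (n + 1)))‖ :=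
            ContinuousLinearMap.opNorm_comp_le _ _
        _ ≤ Real.exp c * Real.exp (n * c) := by
            gcongr
            · refine (hc _ (abs_le.1 h1)).trans ?_
              linarith [Real.add_one_le_exp c]
            · exact ih _ h2
        _ = _ := by rw [← Real.exp_add]; ring_nf
  refine ⟨c, hc0, fun t => (key ⌈|t|⌉₊ t (Nat.le_ceil _)).trans ?_⟩
  rw [← Real.exp_add]
  gcongr
  have := (Nat.ceil_lt_add_one (abs_nonneg t)).le
  nlinarith

variable [NormedSpace ℝ E] [IsScalarTower ℝ 𝕜 E]

/-- `(x, y)` is in the graph of the generator of the group. -/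
def IsGen (x y : E) : Prop := HasDerivAt (fun t => G.op t x) y 0

variable {G}

theorem IsGen.hasDerivAt {x y : E} (h : G.IsGen x y) (t : ℝ) :
    HasDerivAt (fun t => G.op t x) (G.op t y) t := by
  have h0 : HasDerivAt (fun s => G.op s x) y (t - t) := by rw [sub_self]; exact h
  have h1 := ((G.op t).restrictScalars ℝ).hasFDerivAt.comp_hasDerivAt t
    (h0.comp_sub_const t t)
  refine h1.congr_of_eventuallyEq (Eventually.of_forall fun s => ?_)
  simp [← op_add_apply]

theorem IsGen.op {x y : E} (h : G.IsGen x y) (t : ℝ) : G.IsGen (G.op t x) (G.op t y) := by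
  have h1 := ((G.op t).restrictScalars ℝ).hasFDerivAt.comp_hasDerivAt 0 (show HasDerivAt _ _ _ from h)
  refine h1.congr_of_eventuallyEq (Eventually.of_forall fun s => ?_)
  simp [← op_add_apply, add_comm]

variable [CompleteSpace E]

/-- Product rule at time zero. -/
theorem IsGen.hasDerivAt_op_apply_zero {f : ℝ → E} {f' y : E} (hy : G.IsGen (f 0) y)
    (hf : HasDerivAt f f' 0) : HasDerivAt (fun t => G.op t (f t)) (f' + y) 0 := by
  -- After subtracting `f 0` the difference quotient is `G.op t` applied to that of `f`, and joint
  -- continuity gives the limit. Only `f 0` has to lie in the domain of the generator.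
  have h1 : HasDerivAt (fun t => G.op t (f t - f 0)) f' 0 := by
    rw [hasDerivAt_iff_tendsto_slope_zero] at hf ⊢
    have hc : Tendsto (fun p : ℝ × E => G.op p.1 p.2) (𝓝 (0, f')) (𝓝 f') := by
      simpa using G.continuous_uncurry.tendsto (0, f')
    have := hc.comp ((tendsto_id.mono_left nhdsWithin_le_nhds).prodMk_nhds hf)
    refine this.congr fun t => ?_
    have e : ∀ (r : ℝ) (z : E), G.op t (r • z) = r • G.op t z := fun r z =>
      ((G.op t).restrictScalars ℝ).map_smul r z
    simp [e]
  refine (h1.add (show HasDerivAt _ _ _ from hy)).congr_of_eventuallyEq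
    (Eventually.of_forall fun t => ?_)
  simp

theorem IsGen.hasDerivAt_op_neg_apply_zero {f : ℝ → E} {f' y : E} (hy : G.IsGen (f 0) y)
    (hf : HasDerivAt f f' 0) : HasDerivAt (fun t => G.op (-t) (f t)) (f' - y) 0 := by
  have h1 : HasDerivAt (fun t => f (-t)) (-f') 0 := by
    have h0 : HasDerivAt f f' (-0) := by simpa using hf
    simpa [Function.comp_def] using h0.scomp 0 (hasDerivAt_neg (0 : ℝ))
  have h2 : HasDerivAt (fun t => G.op t (f (-t))) (-f' + y) (-0) := by
    rw [neg_zero]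
    exact IsGen.hasDerivAt_op_apply_zero (f := fun t => f (-t)) (by simpa using hy) h1
  simpa [Function.comp_def, sub_eq_add_neg, add_comm] using h2.scomp 0 (hasDerivAt_neg (0 : ℝ))

/-- The orbits are the only solutions of the abstract Cauchy problem. -/
theorem eq_op_of_hasDerivAt {U V : ℝ → E} (hU : ∀ t, HasDerivAt U (V t) t)
    (hV : ∀ t, G.IsGen (U t) (V t)) (t : ℝ) : U t = G.op t (U 0) := by
  -- Factoring out `G.op (-s)` moves the derivative to time zero, where the product rule gives `V s
  -- - V s`.
  have hd : ∀ s, HasDerivAt (fun s => G.op (-s) (U s)) 0 s := by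
    intro s
    have h0 : HasDerivAt (fun r => U (s + r)) (V s) 0 := by
      have : HasDerivAt U (V s) (s + 0) := by simpa using hU s
      exact this.comp_const_add s 0
    have h1 := IsGen.hasDerivAt_op_neg_apply_zero (G := G) (f := fun r => U (s + r))
      (by simpa using hV s) h0
    rw [sub_self] at h1
    have h2 := ((G.op (-s)).restrictScalars ℝ).hasFDerivAt.comp_hasDerivAt 0 h1
    have h3 : HasDerivAt (fun r => G.op (-(s + r)) (U (s + r))) 0 (s - s) := by
      rw [sub_self]
      refine (h2.congr_of_eventuallyEq (Eventually.of_forall fun r => ?_)).congr_deriv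
        (by simp)
      simp [← op_add_apply, add_comm]
    have h4 := h3.comp_sub_const s s
    simpa using h4
  have := is_const_of_deriv_eq_zero (fun s => (hd s).differentiableAt) (fun s => (hd s).deriv) t 0
  simp only [neg_zero, op_zero_apply] at this
  rw [← this, op_apply_neg]

end C0Group

/-! ### Duhamel equation and bounded perturbations -/

/-- Integral bound for exponentially growing integrands. -/
theorem norm_intervalIntegral_le_exp {E : Type*} [NormedAddCommGroup E] [NormedSpace ℝ E]
    {f : ℝ → E} {C a t : ℝ} (ha : 0 < a) (hC : 0 ≤ C)
    (hf : ∀ s ∈ Set.uIcc 0 t, ‖f s‖ ≤ C * Real.exp (a * |s|)) :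
    ‖∫ s in (0 : ℝ)..t, f s‖ ≤ C / a * Real.exp (a * |t|) := by
  have main : ∀ (g : ℝ → E) (r : ℝ), 0 ≤ r →
      (∀ s ∈ Set.Icc 0 r, ‖g s‖ ≤ C * Real.exp (a * s)) →
      ‖∫ s in (0 : ℝ)..r, g s‖ ≤ C / a * Real.exp (a * r) := by
    intro g r hr hg
    have h1 : ‖∫ s in (0 : ℝ)..r, g s‖ ≤ ∫ s in (0 : ℝ)..r, C * Real.exp (a * s) := by
      refine intervalIntegral.norm_integral_le_of_norm_le hr
        (Eventually.of_forall fun s hs => hg s ⟨hs.1.le, hs.2⟩) ?_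
      exact Continuous.intervalIntegrable (by fun_prop) _ _
    have h2 : ∫ s in (0 : ℝ)..r, C * Real.exp (a * s) =
        C / a * Real.exp (a * r) - C / a * Real.exp (a * 0) := by
      refine intervalIntegral.integral_eq_sub_of_hasDerivAt
        (f := fun s => C / a * Real.exp (a * s)) (fun s _ => ?_)
        (Continuous.intervalIntegrable (by fun_prop) _ _)
      have := (((hasDerivAt_id s).const_mul a).exp).const_mul (C / a)
      refine this.congr_deriv ?_
      simp only [id]
      field_simp
    have h3 : 0 ≤ C / a * Real.exp (a * 0) := by positivity
    linarith
  rcases le_total 0 t with ht | ht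
  · rw [abs_of_nonneg ht]
    refine main f t ht fun s hs => ?_
    have := hf s (by rwa [Set.uIcc_of_le ht])
    rwa [abs_of_nonneg hs.1] at this
  · rw [abs_of_nonpos ht]
    have e : ∫ s in (0 : ℝ)..t, f s = -∫ s in (0 : ℝ)..(-t), f (-s) := by
      rw [intervalIntegral.integral_comp_neg, neg_neg, neg_zero, intervalIntegral.integral_symm]
    rw [e, norm_neg]
    refine main _ (-t) (by linarith) fun s hs => ?_
    have := hf (-s) (by rw [Set.uIcc_of_ge ht]; constructor <;> linarith [hs.1, hs.2])
    rwa [abs_neg, abs_of_nonneg hs.1] at this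

namespace C0Group

variable {𝕜 E : Type*} [RCLike 𝕜] [NormedAddCommGroup E] [NormedSpace 𝕜 E]
  [NormedSpace ℝ E] (G : C0Group 𝕜 E) (P : E →L[𝕜] E)

/-- The convolution `∫₀ᵗ G(t - s) P F(s) ds`, written with a fixed integrand. -/
def duhamel (F : ℝ → E) (t : ℝ) : E := G.op t (∫ s in (0 : ℝ)..t, G.op (-s) (P (F s)))

variable {G P} [CompleteSpace E]

omit [NormedSpace ℝ E] in
theorem continuous_duhamel_integrand {F : ℝ → E} (hF : Continuous F) :
    Continuous fun s => G.op (-s) (P (F s)) :=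
  G.continuous_op_comp (by fun_prop) (P.continuous.comp hF)

theorem continuous_duhamel {F : ℝ → E} (hF : Continuous F) : Continuous (G.duhamel P F) :=
  G.continuous_op_comp continuous_id
    (intervalIntegral.continuous_primitive
      (fun _ _ => (continuous_duhamel_integrand hF).intervalIntegrable _ _) 0)

theorem duhamel_eq {F : ℝ → E} (hF : Continuous F) (t : ℝ) :
    G.duhamel P F t = ∫ s in (0 : ℝ)..t, G.op (t - s) (P (F s)) := by
  rw [duhamel, ← ContinuousLinearMap.intervalIntegral_comp_comm _
    ((continuous_duhamel_integrand hF).intervalIntegrable _ _)]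
  simp only [sub_eq_add_neg, op_add_apply]

/-- For `s` between `0` and `t` one has `|t - s| = |t| - |s|`, so the growth of the group cancels
and only `exp (a * |s|)` is integrated. In the sup norm weighted by `exp (-(c + a) * |t|)` the
convolution thus has norm at most `m * ‖P‖ / a`, which is small for large `a`. -/
theorem norm_duhamel_le {F : ℝ → E} (hF : Continuous F) {m c a B : ℝ} (ha : 0 < a) (hm : 0 ≤ m)
    (hG : ∀ t, ‖G.op t‖ ≤ m * Real.exp (c * |t|))
    (hB : 0 ≤ B) (hFB : ∀ s, ‖F s‖ ≤ B * Real.exp ((c + a) * |s|)) (t : ℝ) :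
    ‖G.duhamel P F t‖ ≤ m * ‖P‖ * B / a * Real.exp ((c + a) * |t|) := by
  rw [duhamel_eq hF]
  have h := norm_intervalIntegral_le_exp (f := fun s => G.op (t - s) (P (F s)))
    (C := m * ‖P‖ * B * Real.exp (c * |t|)) (a := a) (t := t) ha (by positivity) ?_
  · refine h.trans_eq ?_
    rw [add_mul, Real.exp_add]
    ring
  · intro s hs
    have habs : |t - s| = |t| - |s| := by
      rcases le_total 0 t with ht | ht
      · rw [Set.uIcc_of_le ht] at hs
        rw [abs_of_nonneg (sub_nonneg.2 hs.2), abs_of_nonneg ht, abs_of_nonneg hs.1]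
      · rw [Set.uIcc_of_ge ht] at hs
        rw [abs_of_nonpos (by linarith [hs.1]), abs_of_nonpos ht, abs_of_nonpos hs.2]
        ring
    calc ‖G.op (t - s) (P (F s))‖ ≤ (m * Real.exp (c * |t - s|)) *
          (‖P‖ * (B * Real.exp ((c + a) * |s|))) := by
          refine (G.op _).le_of_opNorm_le_of_le (hG _) ?_
          exact P.le_of_opNorm_le_of_le le_rfl (hFB s)
      _ = m * ‖P‖ * B * Real.exp (c * |t|) * Real.exp (a * |s|) := by
          rw [habs]
          have : Real.exp (c * (|t| - |s|)) * Real.exp ((c + a) * |s|) =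
            Real.exp (c * |t|) * Real.exp (a * |s|) := by
              rw [← Real.exp_add, ← Real.exp_add]; ring_nf
          linear_combination m * ‖P‖ * B * this

theorem duhamel_add {F F' : ℝ → E} (hF : Continuous F) (hF' : Continuous F') (t : ℝ) :
    G.duhamel P (fun s => F s + F' s) t = G.duhamel P F t + G.duhamel P F' t := by
  simp only [duhamel, map_add]
  rw [intervalIntegral.integral_add
    ((continuous_duhamel_integrand hF).intervalIntegrable _ _)
    ((continuous_duhamel_integrand hF').intervalIntegrable _ _), map_add]

theorem duhamel_sub {F F' : ℝ → E} (hF : Continuous F) (hF' : Continuous F') (t : ℝ) :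
    G.duhamel P (fun s => F s - F' s) t = G.duhamel P F t - G.duhamel P F' t := by
  simp only [duhamel, map_sub]
  rw [intervalIntegral.integral_sub
    ((continuous_duhamel_integrand hF).intervalIntegrable _ _)
    ((continuous_duhamel_integrand hF').intervalIntegrable _ _), map_sub]

omit [CompleteSpace E] in
theorem duhamel_smul [SMulCommClass ℝ 𝕜 E] (c : 𝕜) (F : ℝ → E) (t : ℝ) :
    G.duhamel P (fun s => c • F s) t = c • G.duhamel P F t := by
  simp only [duhamel, map_smul, intervalIntegral.integral_smul]

/-- The Duhamel equation has at most one exponentially bounded solution. -/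
theorem eq_zero_of_eq_duhamel {m c a B : ℝ} (ha : 0 < a) (hm : 0 ≤ m)
    (hG : ∀ t, ‖G.op t‖ ≤ m * Real.exp (c * |t|)) (hma : m * ‖P‖ / a ≤ 1 / 2) {F : ℝ → E}
    (hF : Continuous F) (hB : 0 ≤ B) (hFB : ∀ s, ‖F s‖ ≤ B * Real.exp ((c + a) * |s|))
    (h : ∀ t, F t = G.duhamel P F t) (t : ℝ) : F t = 0 := by
  have key : ∀ (n : ℕ) (s : ℝ), ‖F s‖ ≤ (1 / 2) ^ n * B * Real.exp ((c + a) * |s|) := by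
    intro n
    induction n with
    | zero => simpa using hFB
    | succ n ih =>
      intro s
      rw [h s]
      refine (norm_duhamel_le hF ha hm hG (by positivity) ih s).trans ?_
      gcongr
      calc m * ‖P‖ * ((1 / 2) ^ n * B) / a = (m * ‖P‖ / a) * ((1 / 2) ^ n * B) := by ring
        _ ≤ (1 / 2) * ((1 / 2) ^ n * B) := by gcongr
        _ = _ := by ring
  have hlim : Tendsto (fun n : ℕ => (1 / 2 : ℝ) ^ n * B * Real.exp ((c + a) * |t|)) atTop (𝓝 0) := by
    have := (tendsto_pow_atTop_nhds_zero_of_lt_one (r := (1 / 2 : ℝ)) (by norm_num)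
      (by norm_num)).mul_const (B * Real.exp ((c + a) * |t|))
    simpa [mul_assoc] using this
  exact norm_le_zero_iff.1 (ge_of_tendsto' hlim fun n => key n t)

open scoped BoundedContinuousFunction

/-- The Duhamel equation is solvable, with bounded linear dependence on the initial value. -/
theorem exists_duhamel_solution [IsScalarTower ℝ 𝕜 E] {m c a : ℝ} (ha : 0 < a) (hm : 0 ≤ m)
    (hG : ∀ t, ‖G.op t‖ ≤ m * Real.exp (c * |t|)) (hma : m * ‖P‖ / a ≤ 1 / 2) :
    ∃ (S : ℝ → E →L[𝕜] E) (B : ℝ), 0 ≤ B ∧ (∀ x, Continuous fun t => S t x) ∧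
      (∀ t, ‖S t‖ ≤ B * Real.exp ((c + a) * |t|)) ∧
      ∀ t x, S t x = G.op t x + G.duhamel P (fun s => S s x) t := by
  set ω := c + a with hω
  have hsm : ∀ (r : ℝ) (k : 𝕜) (x : E), r • k • x = k • r • x := fun r k x => smul_comm r k x
  have hFc : ∀ F : ℝ →ᵇ E, Continuous fun s => Real.exp (ω * |s|) • F s := fun F => by fun_prop
  have hexp : ∀ t : ℝ, Real.exp (-(ω * |t|)) * Real.exp (ω * |t|) = 1 := fun t => by
    rw [← Real.exp_add]; simp
  have hVb : ∀ (F : ℝ →ᵇ E) t, ‖Real.exp (-(ω * |t|)) •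
      G.duhamel P (fun s => Real.exp (ω * |s|) • F s) t‖ ≤ 1 / 2 * ‖F‖ := by
    intro F t
    have h1 := norm_duhamel_le (P := P) (hFc F) ha hm hG (norm_nonneg F) (fun s => by
      rw [norm_smul, Real.norm_of_nonneg (Real.exp_pos _).le, mul_comm, ← hω]
      gcongr
      exact F.norm_coe_le_norm s) t
    rw [norm_smul, Real.norm_of_nonneg (Real.exp_pos _).le]
    calc _ ≤ Real.exp (-(ω * |t|)) * (m * ‖P‖ * ‖F‖ / a * Real.exp (ω * |t|)) := by gcongr
      _ = (m * ‖P‖ / a) * ‖F‖ * (Real.exp (-(ω * |t|)) * Real.exp (ω * |t|)) := by ring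
      _ ≤ _ := by rw [hexp, mul_one]; gcongr
  -- The convolution conjugated by the exponential weight. Its norm is at most `1 / 2`, so `1 - V`
  -- is invertible and the weighted solution is `(1 - V)⁻¹` of the weighted orbit, which is bounded
  -- and linear in `x`.
  let V : (ℝ →ᵇ E) →L[𝕜] (ℝ →ᵇ E) := LinearMap.mkContinuous
    { toFun := fun F => BoundedContinuousFunction.ofNormedAddCommGroup
        (fun t => Real.exp (-(ω * |t|)) • G.duhamel P (fun s => Real.exp (ω * |s|) • F s) t)
        ((by fun_prop : Continuous fun t : ℝ => Real.exp (-(ω * |t|))).smul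
          (continuous_duhamel (hFc F))) (1 / 2 * ‖F‖) (hVb F)
      map_add' := fun F F' => by
        ext t
        simp only [BoundedContinuousFunction.coe_ofNormedAddCommGroup,
          BoundedContinuousFunction.add_apply, smul_add]
        rw [duhamel_add (hFc F) (hFc F'), smul_add]
      map_smul' := fun k F => by
        ext t
        simp only [BoundedContinuousFunction.coe_ofNormedAddCommGroup,
          BoundedContinuousFunction.coe_smul, RingHom.id_apply, hsm]
        rw [duhamel_smul, hsm] } (1 / 2)
    (fun F => BoundedContinuousFunction.norm_ofNormedAddCommGroup_le _ (by positivity) (hVb F))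
  have hV : ‖V‖ < 1 := (LinearMap.mkContinuous_norm_le _ (by norm_num) _).trans_lt (by norm_num)
  let W := Units.oneSub V hV
  have hW : ∀ F, ((↑W⁻¹ : (ℝ →ᵇ E) →L[𝕜] (ℝ →ᵇ E)) F) - V ((↑W⁻¹ : (ℝ →ᵇ E) →L[𝕜] (ℝ →ᵇ E)) F)
      = F := by
    intro F
    have := congrArg (fun T : (ℝ →ᵇ E) →L[𝕜] (ℝ →ᵇ E) => T F) W.mul_inv
    simpa [W, Units.val_oneSub] using this
  have hΓb : ∀ x t, ‖Real.exp (-(ω * |t|)) • G.op t x‖ ≤ m * ‖x‖ := by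
    intro x t
    rw [norm_smul, Real.norm_of_nonneg (Real.exp_pos _).le]
    have h2 : Real.exp (-(ω * |t|)) * Real.exp (c * |t|) ≤ 1 := by
      rw [← Real.exp_add, Real.exp_le_one_iff, hω]
      nlinarith [abs_nonneg t]
    calc _ ≤ Real.exp (-(ω * |t|)) * (m * Real.exp (c * |t|) * ‖x‖) := by
          gcongr; exact (G.op t).le_of_opNorm_le (hG t) x
      _ = (Real.exp (-(ω * |t|)) * Real.exp (c * |t|)) * (m * ‖x‖) := by ring
      _ ≤ 1 * (m * ‖x‖) := by gcongr
      _ = _ := one_mul _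
  let Γ : E →L[𝕜] (ℝ →ᵇ E) := LinearMap.mkContinuous
    { toFun := fun x => BoundedContinuousFunction.ofNormedAddCommGroup
        (fun t => Real.exp (-(ω * |t|)) • G.op t x)
        ((by fun_prop : Continuous fun t : ℝ => Real.exp (-(ω * |t|))).smul
          (G.continuous_orbit x)) (m * ‖x‖) (hΓb x)
      map_add' := fun x y => by ext t; simp
      map_smul' := fun k x => by ext t; simp [hsm] } m
    (fun x => BoundedContinuousFunction.norm_ofNormedAddCommGroup_le _ (by positivity) (hΓb x))
  let Φ : E →L[𝕜] (ℝ →ᵇ E) := (↑W⁻¹ : (ℝ →ᵇ E) →L[𝕜] (ℝ →ᵇ E)).comp Γ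
  refine ⟨fun t => Real.exp (ω * |t|) • (BoundedContinuousFunction.evalCLM 𝕜 t).comp Φ, ‖Φ‖,
    norm_nonneg _, fun x => ?_, fun t => ?_, fun t x => ?_⟩
  · exact hFc (Φ x)
  · refine ContinuousLinearMap.opNorm_le_bound _ (by positivity) fun x => ?_
    change ‖Real.exp (ω * |t|) • Φ x t‖ ≤ _
    rw [norm_smul, Real.norm_of_nonneg (Real.exp_pos _).le]
    calc _ ≤ Real.exp (ω * |t|) * (‖Φ‖ * ‖x‖) := by
          gcongr
          exact ((Φ x).norm_coe_le_norm t).trans (Φ.le_opNorm x)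
      _ = _ := by ring
  · change Real.exp (ω * |t|) • Φ x t =
      G.op t x + G.duhamel P (fun s => Real.exp (ω * |s|) • Φ x s) t
    have h1 := congrArg (fun F : ℝ →ᵇ E => F t) (hW (Γ x))
    have h2 : Φ x t - Real.exp (-(ω * |t|)) • G.duhamel P (fun s => Real.exp (ω * |s|) • Φ x s) t
      = Real.exp (-(ω * |t|)) • G.op t x := h1
    have h3 := congrArg (fun z => Real.exp (ω * |t|) • z) (sub_eq_iff_eq_add.1 h2)
    simpa [smul_smul, mul_comm (Real.exp (ω * |t|)), hexp] using h3

/-- Splitting the integral at `s` restarts the Duhamel equation at time `s`. Hence a solution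
translated by `s` solves the same equation with its value at `s` as initial value, which yields the
group law for the perturbed family. -/
theorem duhamel_shift {S : ℝ → E} (hS : Continuous S) (x : E) (s t : ℝ) :
    G.op (t + s) x + G.duhamel P S (t + s) =
      G.op t (G.op s x + G.duhamel P S s) + G.duhamel P (fun r => S (r + s)) t := by
  have hi := fun p q => (continuous_duhamel_integrand (G := G) (P := P) hS).intervalIntegrable
    (μ := MeasureTheory.volume) p q
  have hS' : Continuous fun r => S (r + s) := by fun_prop
  have e1 : ∫ r in (0 : ℝ)..t, G.op (-r) (P (S (r + s))) =
      G.op s (∫ r in s..(t + s), G.op (-r) (P (S r))) := by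
    rw [← ContinuousLinearMap.intervalIntegral_comp_comm _ (hi _ _)]
    have := intervalIntegral.integral_comp_add_right
      (a := (0 : ℝ)) (b := t) (fun r => G.op s (G.op (-r) (P (S r)))) s
    rw [zero_add] at this
    rw [← this]
    simp [← op_add_apply]
  rw [duhamel, duhamel, duhamel, e1,
    ← intervalIntegral.integral_add_adjacent_intervals (hi 0 s) (hi s (t + s))]
  simp only [op_add_apply, map_add]
  abel

/-- Bounded perturbation theorem for strongly continuous groups. -/
theorem exists_perturbation [IsScalarTower ℝ 𝕜 E] (G : C0Group 𝕜 E) (P : E →L[𝕜] E) :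
    ∃ S : C0Group 𝕜 E, ∀ x y, S.IsGen x (y + P x) ↔ G.IsGen x y := by
  obtain ⟨c, hc0, hc⟩ := G.exists_norm_le_exp
  set m := Real.exp c with hm
  have hm0 : 0 < m := Real.exp_pos c
  -- The factor `2` makes the contraction constant at most `1 / 2`; the summand `1` keeps `a`
  -- positive when `P = 0`.
  set a := 2 * (m * ‖P‖) + 1 with ha
  have ha0 : 0 < a := by positivity
  have hma : m * ‖P‖ / a ≤ 1 / 2 := by
    rw [div_le_iff₀ ha0]; linarith
  obtain ⟨S, B, hB0, hSc, hSB, hS⟩ := exists_duhamel_solution (P := P) ha0 hm0.le hc hma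
  have hSx : ∀ t x, ‖S t x‖ ≤ B * Real.exp ((c + a) * |t|) * ‖x‖ := fun t x =>
    (S t).le_of_opNorm_le (hSB t) x
  have hadd : ∀ t s x, S (t + s) x = S t (S s x) := by
    intro t s x
    have hcont1 : Continuous fun r => S (r + s) x := (hSc x).comp (continuous_id.add continuous_const)
    rw [← sub_eq_zero]
    refine eq_zero_of_eq_duhamel (F := fun r => S (r + s) x - S r (S s x))
      (B := B * Real.exp ((c + a) * |s|) * ‖x‖ + B * ‖S s x‖) ha0 hm0.le hc hma
      (hcont1.sub (hSc _)) (by positivity) (fun r => ?_) (fun r => ?_) t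
    · refine (norm_sub_le _ _).trans ?_
      rw [add_mul]
      refine add_le_add ((hSx _ _).trans ?_) ((hSx _ _).trans_eq (by ring))
      have : Real.exp ((c + a) * |r + s|) ≤ Real.exp ((c + a) * |s|) * Real.exp ((c + a) * |r|) := by
        rw [← Real.exp_add]
        gcongr
        nlinarith [abs_add_le r s]
      calc _ ≤ B * (Real.exp ((c + a) * |s|) * Real.exp ((c + a) * |r|)) * ‖x‖ := by gcongr
        _ = _ := by ring
    · rw [duhamel_sub hcont1 (hSc _), hS (r + s) x, duhamel_shift (hSc x), ← hS s x,
        hS r (S s x)]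
      abel
  have hS0 : S 0 = ContinuousLinearMap.id 𝕜 E := by
    ext x
    rw [hS]
    simp [duhamel]
  let S' : C0Group 𝕜 E := ⟨S, hS0, fun s t => by ext x; exact hadd s t x, hSc⟩
  refine ⟨S', fun x y => ?_⟩
  -- The Duhamel term has derivative `P x` at zero for every `x`, in the domain or not. So the
  -- perturbed and unperturbed orbits of `x` are differentiable at zero simultaneously.
  have hd : HasDerivAt (fun t => G.duhamel P (fun s => S s x) t) (P x) 0 := by
    have h1 : HasDerivAt (fun t => ∫ s in (0 : ℝ)..t, G.op (-s) (P (S s x))) (P x) 0 := by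
      have := (continuous_duhamel_integrand (G := G) (P := P) (hSc x)).integral_hasStrictDerivAt 0 0
      simpa [hS0] using this.hasDerivAt
    have h0 : G.IsGen (∫ s in (0 : ℝ)..0, G.op (-s) (P (S s x))) 0 := by
      simpa [IsGen] using hasDerivAt_const (0 : ℝ) (0 : E)
    simpa [duhamel] using IsGen.hasDerivAt_op_apply_zero h0 h1
  constructor
  · intro h
    have := HasDerivAt.sub (show HasDerivAt (fun t => S t x) (y + P x) 0 from h) hd
    rw [add_sub_cancel_right] at this
    exact this.congr_of_eventuallyEq (Eventually.of_forall fun t => by simp [hS t x])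
  · intro h
    have := HasDerivAt.add (show HasDerivAt (fun t => G.op t x) y 0 from h) hd
    exact this.congr_of_eventuallyEq (Eventually.of_forall fun t => by simp [S', hS t x])

end C0Group

/-! ### Semigroups and their extension to groups -/

namespace C0Semigroup

variable {𝕜 E : Type*} [RCLike 𝕜] [NormedAddCommGroup E] [NormedSpace 𝕜 E]
  (T : C0Semigroup 𝕜 E)

/-- The semigroup with real times; constant for negative times. -/
def opReal (t : ℝ) : E →L[𝕜] E := T.op t.toNNReal

@[simp] theorem opReal_zero_apply (x : E) : T.opReal 0 x = x := by simp [opReal, T.op_zero]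

theorem opReal_add_apply {s t : ℝ} (hs : 0 ≤ s) (ht : 0 ≤ t) (x : E) :
    T.opReal (s + t) x = T.opReal s (T.opReal t x) := by
  simp [opReal, Real.toNNReal_add hs ht, T.op_add]

theorem continuous_opReal (x : E) : Continuous fun t => T.opReal t x :=
  (T.continuous_orbit x).comp continuous_real_toNNReal

theorem continuous_opReal_uncurry [CompleteSpace E] :
    Continuous fun p : ℝ × E => T.opReal p.1 p.2 :=
  continuous_uncurry_of_pointwise T.continuous_opReal

variable [NormedSpace ℝ E] {T}

theorem mem_generatorGraph_iff {x y : E} : (x, y) ∈ T.generatorGraph ↔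
    HasDerivWithinAt (fun t => T.opReal t x) y (Set.Ici 0) 0 := by
  rw [← hasDerivWithinAt_Ioi_iff_Ici, hasDerivWithinAt_iff_tendsto_slope' (by simp)]
  change Tendsto (fun t : ℝ≥0 => (t : ℝ)⁻¹ • (T.op t x - x)) (𝓝[>] 0) (𝓝 y) ↔ _
  constructor
  · intro h
    have h1 : Tendsto Real.toNNReal (𝓝[>] 0) (𝓝[>] 0) := by
      refine tendsto_nhdsWithin_iff.2 ⟨?_, ?_⟩
      · have := continuous_real_toNNReal.tendsto 0
        rw [Real.toNNReal_zero] at this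
        exact this.mono_left nhdsWithin_le_nhds
      · filter_upwards [self_mem_nhdsWithin] with t ht
        exact Real.toNNReal_pos.2 ht
    refine (h.comp h1).congr' ?_
    filter_upwards [self_mem_nhdsWithin] with t ht
    simp [slope_def_module, opReal, T.op_zero, Real.coe_toNNReal t (le_of_lt ht)]
  · intro h
    have h1 : Tendsto (fun t : ℝ≥0 => (t : ℝ)) (𝓝[>] 0) (𝓝[>] 0) := by
      refine tendsto_nhdsWithin_iff.2 ⟨?_, ?_⟩
      · have := NNReal.continuous_coe.tendsto 0
        rw [NNReal.coe_zero] at this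
        exact this.mono_left nhdsWithin_le_nhds
      · filter_upwards [self_mem_nhdsWithin] with t ht
        exact NNReal.coe_pos.2 ht
    refine (h.comp h1).congr fun t => ?_
    simp [slope_def_module, opReal, T.op_zero]

variable [IsScalarTower ℝ 𝕜 E]

theorem opReal_mem_generatorGraph {x y : E} (h : (x, y) ∈ T.generatorGraph) {t : ℝ} (ht : 0 ≤ t) :
    (T.opReal t x, T.opReal t y) ∈ T.generatorGraph := by
  rw [mem_generatorGraph_iff] at h ⊢
  have h1 := ((T.opReal t).restrictScalars ℝ).hasFDerivAt.comp_hasDerivWithinAt 0 h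
  refine h1.congr (fun s hs => ?_) ?_
  · simp [← T.opReal_add_apply hs ht, ← T.opReal_add_apply ht hs, add_comm]
  · simp

theorem smul_mem_generatorGraph {x y : E} (h : (x, y) ∈ T.generatorGraph) (r : ℝ) :
    (r • x, r • y) ∈ T.generatorGraph := by
  rw [mem_generatorGraph_iff] at h ⊢
  refine (h.const_smul r).congr_of_eventuallyEq (Eventually.of_forall fun t => ?_) ?_
  · exact ((T.opReal t).restrictScalars ℝ).map_smul r x
  · exact ((T.opReal 0).restrictScalars ℝ).map_smul r x

variable [CompleteSpace E]

theorem hasDerivWithinAt_opReal_apply {f : ℝ → E} {f' y : E} (hy : (f 0, y) ∈ T.generatorGraph)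
    (hf : HasDerivWithinAt f f' (Set.Ici 0) 0) :
    HasDerivWithinAt (fun t => T.opReal t (f t)) (f' + y) (Set.Ici 0) 0 := by
  have h1 : HasDerivWithinAt (fun t => T.opReal t (f t - f 0)) f' (Set.Ici 0) 0 := by
    rw [hasDerivWithinAt_iff_tendsto_slope] at hf ⊢
    have hc : Tendsto (fun p : ℝ × E => T.opReal p.1 p.2) (𝓝 (0, f')) (𝓝 f') := by
      simpa using T.continuous_opReal_uncurry.tendsto (0, f')
    have := hc.comp ((tendsto_id.mono_left nhdsWithin_le_nhds).prodMk_nhds hf)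
    refine this.congr fun t => ?_
    have e : ∀ (r : ℝ) (z : E), T.opReal t (r • z) = r • T.opReal t z := fun r z =>
      ((T.opReal t).restrictScalars ℝ).map_smul r z
    simp [slope_def_module, e]
  refine (h1.add (mem_generatorGraph_iff.1 hy)).congr_of_eventuallyEq
    (Eventually.of_forall fun t => ?_) ?_
  · simp
  · simp

variable (T) in
/-- The generator of a strongly continuous semigroup is densely defined. -/
theorem dense_domain : Dense {x | ∃ y, (x, y) ∈ T.generatorGraph} := by
  intro x
  have hi := fun a b => (T.continuous_opReal x).intervalIntegrable (μ := MeasureTheory.volume) a b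
  set F : ℝ → E := fun t => ∫ s in (0 : ℝ)..t, T.opReal s x with hF
  have hFd : ∀ t, HasDerivAt F (T.opReal t x) t := fun t =>
    ((T.continuous_opReal x).integral_hasStrictDerivAt 0 t).hasDerivAt
  -- The integrals of an orbit over `[0, h]` lie in the domain; divided by `h` they converge to `x`.
  have hmem : ∀ h : ℝ, 0 ≤ h → (F h, T.opReal h x - x) ∈ T.generatorGraph := by
    intro h hh
    rw [mem_generatorGraph_iff]
    have h1 : HasDerivAt (fun t => F (t + h) - F t) (T.opReal h x - x) 0 := by
      have a1 : HasDerivAt F (T.opReal h x) (0 + h) := by simpa using hFd h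
      exact ((a1.comp_add_const 0 h).sub (hFd 0)).congr_deriv (by simp)
    have e : ∀ t ∈ Set.Ici (0 : ℝ), T.opReal t (F h) = F (t + h) - F t := by
      intro t ht
      rw [hF]
      dsimp only
      rw [intervalIntegral.integral_interval_sub_left (hi _ _) (hi _ _),
        ← ContinuousLinearMap.intervalIntegral_comp_comm _ (hi _ _)]
      have := intervalIntegral.integral_comp_add_left
        (a := (0 : ℝ)) (b := h) (fun r => T.opReal r x) t
      rw [add_zero] at this
      rw [← this]
      refine intervalIntegral.integral_congr fun s hs => ?_
      rw [Set.uIcc_of_le hh] at hs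
      exact (T.opReal_add_apply ht hs.1 x).symm
    exact h1.hasDerivWithinAt.congr e (e 0 Set.self_mem_Ici)
  have hlim : Tendsto (fun h : ℝ => h⁻¹ • F h) (𝓝[>] 0) (𝓝 x) := by
    have := (hFd 0).hasDerivWithinAt (s := Set.Ioi 0)
    rw [hasDerivWithinAt_iff_tendsto_slope' (by simp)] at this
    rw [T.opReal_zero_apply] at this
    exact this.congr fun h => by simp [slope_def_module, hF]
  refine mem_closure_of_tendsto hlim ?_
  filter_upwards [self_mem_nhdsWithin] with h hh
  exact ⟨_, smul_mem_generatorGraph (hmem h (le_of_lt hh)) h⁻¹⟩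

/-- If `J` is an involution with `J 𝒢 J = -𝒢`, where `𝒢` is the generator of `T`, then `J T(t) J`
inverts `T(t)`. -/
theorem opReal_comp_reflect {J : E →L[𝕜] E} (hJ : ∀ x, J (J x) = x)
    (hJT : ∀ x y, (x, y) ∈ T.generatorGraph → (J x, -J y) ∈ T.generatorGraph) {t : ℝ} (ht : 0 ≤ t)
    (x : E) : T.opReal t (J (T.opReal t (J x))) = x := by
  -- On the domain, `T(t) J T(t) x` has zero right derivative, because the two generator terms are
  -- `J T(s) y` and its negative. It therefore keeps its value `J x` from `t = 0`; density does the
  -- rest.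
  have key : ∀ x ∈ {x | ∃ y, (x, y) ∈ T.generatorGraph},
      T.opReal t (J (T.opReal t x)) = J x := by
    rintro x ⟨y, hxy⟩
    have hcont : Continuous fun t => T.opReal t (J (T.opReal t x)) :=
      T.continuous_opReal_uncurry.comp (continuous_id.prodMk (J.continuous.comp
        (T.continuous_opReal x)))
    have hd : ∀ s ∈ Set.Ico 0 t, HasDerivWithinAt (fun t => T.opReal t (J (T.opReal t x))) 0
        (Set.Ici s) s := by
      intro s hs
      have hz := opReal_mem_generatorGraph hxy hs.1
      have h1 : HasDerivWithinAt (fun r => J (T.opReal r (T.opReal s x))) (J (T.opReal s y))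
          (Set.Ici 0) 0 :=
        (J.restrictScalars ℝ).hasFDerivAt.comp_hasDerivWithinAt 0 (mem_generatorGraph_iff.1 hz)
      have h2 := hasDerivWithinAt_opReal_apply (T := T)
        (f := fun r => J (T.opReal r (T.opReal s x)))
        (by simpa using hJT _ _ hz) h1
      rw [add_neg_cancel] at h2
      have h3 : HasDerivWithinAt (fun r => T.opReal s (T.opReal r (J (T.opReal r (T.opReal s x)))))
          0 (Set.Ici 0) (s - s) := by
        have := ((T.opReal s).restrictScalars ℝ).hasFDerivAt.comp_hasDerivWithinAt 0 h2
        simpa [Function.comp_def] using this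
      have h4 := HasDerivWithinAt.scomp (h := fun r => r - s) s h3 (((hasDerivAt_id s).sub_const s).hasDerivWithinAt (s := Set.Ici s))
        (fun r hr => by simpa using hr)
      rw [smul_zero] at h4
      refine h4.congr (fun r hr => ?_) ?_
      · have hr' : 0 ≤ r - s := sub_nonneg.2 hr
        simp only [Function.comp_def]
        rw [← T.opReal_add_apply hr' hs.1, ← T.opReal_add_apply hs.1 hr']
        simp
      · simp
    have := constant_of_has_deriv_right_zero hcont.continuousOn hd t ⟨ht, le_rfl⟩
    simpa using this
  have hall : (fun x => T.opReal t (J (T.opReal t x))) = J :=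
    Continuous.ext_on T.dense_domain (by fun_prop) J.continuous key
  rw [congrFun hall, hJ]

/-- A strongly continuous semigroup whose generator is similar to its negative through an
involution extends to a group. -/
theorem exists_group {J : E →L[𝕜] E} (hJ : ∀ x, J (J x) = x)
    (hJT : ∀ x y, (x, y) ∈ T.generatorGraph → (J x, -J y) ∈ T.generatorGraph) :
    ∃ G : C0Group 𝕜 E, ∀ x y, G.IsGen x y ↔ (x, y) ∈ T.generatorGraph := by
  have hinv : ∀ (t : ℝ≥0) x, T.op t (J (T.op t (J x))) = x := fun t x => by
    simpa [opReal] using opReal_comp_reflect hJ hJT t.2 x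
  let u : ℝ≥0 → (E →L[𝕜] E)ˣ := fun t =>
    ⟨T.op t, J * T.op t * J, by ext x; simp [hinv], by
      ext x
      have := congrArg J (hinv t (J x))
      simpa [hJ] using this⟩
  have hu : ∀ s t, u (s + t) = u s * u t := fun s t => Units.ext (T.op_add s t)
  have hcomm : ∀ s t, Commute (u s) (u t) := fun s t => by
    rw [Commute, SemiconjBy, ← hu, ← hu, add_comm]
  let g : ℝ → (E →L[𝕜] E)ˣ := fun t => u t.toNNReal * (u (-t).toNNReal)⁻¹
  have hg : ∀ s t, g (s + t) = g s * g t := by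
    intro s t
    -- The decomposition of a real number into positive and negative parts turns additivity of `g`
    -- into an identity among commuting units, without a case distinction on signs.
    have e : (s + t).toNNReal + ((-t).toNNReal + (-s).toNNReal) =
        (s.toNNReal + t.toNNReal) + (-(s + t)).toNNReal := by
      have h : ∀ r : ℝ, r = (r.toNNReal : ℝ) - ((-r).toNNReal : ℝ) := fun r => by
        simp [max_zero_sub_max_neg_zero_eq_self]
      rw [← NNReal.coe_inj]
      push_cast only [NNReal.coe_add]
      linarith [h s, h t, h (s + t)]
    have e' := congrArg u e
    rw [hu, hu, hu _ (-(s + t)).toNNReal, hu s.toNNReal] at e'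
    have c1 := ((hcomm t.toNNReal (-s).toNNReal).inv_right).eq
    have c2 := ((hcomm (-(s + t)).toNNReal (-t).toNNReal).mul_right
      (hcomm (-(s + t)).toNNReal (-s).toNNReal)).inv_right.eq
    simp only [g]
    rw [mul_inv_eq_iff_eq_mul]
    calc u (s + t).toNNReal
        = u s.toNNReal * u t.toNNReal * u (-(s + t)).toNNReal *
          (u (-t).toNNReal * u (-s).toNNReal)⁻¹ := by rw [eq_mul_inv_iff_mul_eq, e']
      _ = u s.toNNReal * u t.toNNReal * ((u (-t).toNNReal * u (-s).toNNReal)⁻¹ *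
          u (-(s + t)).toNNReal) := by rw [← c2]; group
      _ = u s.toNNReal * (u t.toNNReal * (u (-s).toNNReal)⁻¹) * (u (-t).toNNReal)⁻¹ *
          u (-(s + t)).toNNReal := by group
      _ = _ := by rw [c1]; group
  have hgx : ∀ t x, (g t : E →L[𝕜] E) x = T.opReal t (J (T.opReal (-t) (J x))) := fun t x => rfl
  have hg0 : g 0 = 1 := by simp [g]
  let G : C0Group 𝕜 E :=
    { op := fun t => g t
      op_zero := by rw [hg0]; rfl
      op_add := fun s t => by rw [hg]; rfl
      continuous_orbit := fun x => by
        simp only [hgx]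
        exact T.continuous_opReal_uncurry.comp (continuous_id.prodMk (J.continuous.comp
          ((T.continuous_opReal (J x)).comp continuous_neg))) }
  have hpos : ∀ t ∈ Set.Ici (0 : ℝ), ∀ x, G.op t x = T.opReal t x := by
    intro t ht x
    have ht' : 0 ≤ t := ht
    change (g t : E →L[𝕜] E) x = _
    have e : T.opReal (-t) (J x) = J x := by
      simp [opReal, Real.toNNReal_of_nonpos (neg_nonpos.2 ht'), T.op_zero]
    rw [hgx, e, hJ]
  have hneg : ∀ t ∈ Set.Iic (0 : ℝ), ∀ x, G.op t x = J (T.opReal (-t) (J x)) := by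
    intro t ht x
    have ht' : t ≤ 0 := ht
    change (g t : E →L[𝕜] E) x = _
    rw [hgx]
    simp [opReal, Real.toNNReal_of_nonpos ht', T.op_zero]
  refine ⟨G, fun x y => ?_⟩
  constructor
  · intro h
    rw [mem_generatorGraph_iff]
    exact (show HasDerivAt _ _ _ from h).hasDerivWithinAt.congr
      (fun t ht => (hpos t ht x).symm) (hpos 0 Set.self_mem_Ici x).symm
  · intro h
    have h1 : HasDerivWithinAt (fun t => G.op t x) y (Set.Ici 0) 0 :=
      (mem_generatorGraph_iff.1 h).congr (fun t ht => hpos t ht x) (hpos 0 Set.self_mem_Ici x)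
    have h2 : HasDerivWithinAt (fun t => G.op t x) y (Set.Iic 0) 0 := by
      have a1 : HasDerivWithinAt (fun t => T.opReal t (J x)) (-J y) (Set.Ici 0) (-0) := by
        rw [neg_zero]
        exact mem_generatorGraph_iff.1 (hJT _ _ h)
      have a2 := a1.scomp 0 ((hasDerivAt_neg (0 : ℝ)).hasDerivWithinAt (s := Set.Iic 0))
        (fun r hr => by simpa using hr)
      have a3 := (J.restrictScalars ℝ).hasFDerivAt.comp_hasDerivWithinAt 0 a2
      refine HasDerivWithinAt.congr ?_ (fun t ht => hneg t ht x) (hneg 0 Set.self_mem_Iic x)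
      simpa [Function.comp_def, hJ] using a3
    have := h2.union h1
    rwa [Set.Iic_union_Ici, hasDerivWithinAt_univ] at this

end C0Semigroup

/-! ### A resolvent point of a group generator -/

namespace C0Group

variable {𝕜 E : Type*} [RCLike 𝕜] [NormedAddCommGroup E] [NormedSpace 𝕜 E]
  [NormedSpace ℝ E] [IsScalarTower ℝ 𝕜 E] [CompleteSpace E] (G : C0Group 𝕜 E)

/-- Some real number belongs to the resolvent set of the generator of a group. -/
theorem exists_real_resolvent : ∃ l : ℝ, (∀ x, ∃ p y, G.IsGen p y ∧ l • p - y = x) ∧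
    ∀ p, G.IsGen p (l • p) → p = 0 := by
  -- Since `l < exp l`, the operator `N = exp (-l) • G.op 1` is a strict contraction. If `q - N q =
  -- x`, then `∫₀¹ exp (-l s) G(s) q ds` is the resolvent applied to `x`. An eigenvector `p` for `l`
  -- has orbit `exp (l t) • p`, so `p = N p` and `p = 0`.
  set l := ‖G.op 1‖ with hl
  have hsmul : ∀ (t r : ℝ) (z : E), G.op t (r • z) = r • G.op t z := fun t r z =>
    ((G.op t).restrictScalars ℝ).map_smul r z
  set N : E →L[𝕜] E := Real.exp (-l) • G.op 1 with hN
  have hN1 : ‖N‖ < 1 := by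
    rw [hN, norm_smul, Real.norm_of_nonneg (Real.exp_pos _).le, ← hl, Real.exp_neg,
      inv_mul_lt_iff₀ (Real.exp_pos _), mul_one]
    linarith [Real.add_one_le_exp l]
  refine ⟨l, fun x => ?_, fun p hp => ?_⟩
  · let W := Units.oneSub N hN1
    obtain ⟨q, hq⟩ : ∃ q, q - Real.exp (-l) • G.op 1 q = x := by
      refine ⟨(↑W⁻¹ : E →L[𝕜] E) x, ?_⟩
      have := congrArg (fun T : E →L[𝕜] E => T x) W.mul_inv
      simpa [W, Units.val_oneSub, hN] using this
    have hc : Continuous fun s => Real.exp (-(l * s)) • G.op s q :=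
      (by fun_prop : Continuous fun s : ℝ => Real.exp (-(l * s))).smul (G.continuous_orbit q)
    have hi := fun a b => hc.intervalIntegrable (μ := MeasureTheory.volume) a b
    set F : ℝ → E := fun t => ∫ s in (0 : ℝ)..t, Real.exp (-(l * s)) • G.op s q with hF
    have hFd : ∀ t, HasDerivAt F (Real.exp (-(l * t)) • G.op t q) t := fun t =>
      (hc.integral_hasStrictDerivAt 0 t).hasDerivAt
    have e : ∀ t, G.op t (F 1) = Real.exp (l * t) • (F (t + 1) - F t) := by
      intro t
      rw [hF]
      dsimp only
      rw [intervalIntegral.integral_interval_sub_left (hi _ _) (hi _ _),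
        ← ContinuousLinearMap.intervalIntegral_comp_comm _ (hi _ _)]
      have := intervalIntegral.integral_comp_add_left
        (a := (0 : ℝ)) (b := 1) (fun r => Real.exp (-(l * r)) • G.op r q) t
      rw [add_zero] at this
      rw [← this, ← intervalIntegral.integral_smul]
      refine intervalIntegral.integral_congr fun s _ => ?_
      simp only [hsmul, op_add_apply, smul_smul, ← Real.exp_add]
      congr 2
      ring
    refine ⟨F 1, l • F 1 - x, ?_, by abel⟩
    have h1 : HasDerivAt (fun t => Real.exp (l * t) • (F (t + 1) - F t))
        (l • F 1 - x) 0 := by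
      have a1 : HasDerivAt F (Real.exp (-(l * 1)) • G.op 1 q) (0 + 1) := by simpa using hFd 1
      have a2 := (a1.comp_add_const 0 1).sub (hFd 0)
      have a3 := ((hasDerivAt_id (0 : ℝ)).const_mul l).exp.smul a2
      have a4 : F 0 = 0 := by simp [hF]
      refine a3.congr_deriv ?_
      simp [a4, ← hq]
      abel
    exact h1.congr_of_eventuallyEq (Eventually.of_forall e)
  · have hU : ∀ t, HasDerivAt (fun t => Real.exp (l * t) • p) (l • Real.exp (l * t) • p) t := by
      intro t
      have := (((hasDerivAt_id t).const_mul l).exp).smul_const p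
      refine this.congr_deriv ?_
      simp [smul_smul, mul_comm]
    have hV : ∀ t, G.IsGen (Real.exp (l * t) • p) (l • Real.exp (l * t) • p) := by
      intro t
      have := HasDerivAt.const_smul (Real.exp (l * t)) (show HasDerivAt _ _ _ from hp)
      rw [smul_comm]
      exact this.congr_of_eventuallyEq (Eventually.of_forall fun s => hsmul _ _ _)
    have h := eq_op_of_hasDerivAt hU hV 1
    have hNp : p = N p := by
      rw [hN]
      have := congrArg (fun z => Real.exp (-l) • z) h
      simpa [smul_smul, ← Real.exp_add] using this
    by_contra hp0
    have h1 : ‖p‖ ≤ ‖N‖ * ‖p‖ := by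
      conv_lhs => rw [hNp]
      exact N.le_opNorm p
    have h2 : 0 < ‖p‖ := norm_pos_iff.2 hp0
    nlinarith

end C0Group

/-! ### Extension of a group by a trivial factor -/

namespace C0Group

variable {𝕜 E F : Type*} [RCLike 𝕜] [NormedAddCommGroup E] [NormedSpace 𝕜 E]
  [NormedAddCommGroup F] [NormedSpace 𝕜 F]

/-- The group on `E × F` that acts trivially on the second factor. -/
def prodId (G : C0Group 𝕜 E) (F : Type*) [NormedAddCommGroup F] [NormedSpace 𝕜 F] :
    C0Group 𝕜 (E × F) where
  op t := (G.op t).prodMap (ContinuousLinearMap.id 𝕜 F)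
  op_zero := by ext <;> simp
  op_add s t := by ext <;> simp [op_add_apply]
  continuous_orbit x := (G.continuous_orbit x.1).prodMk continuous_const

variable [NormedSpace ℝ E] [NormedSpace ℝ F]

theorem IsGen.hasDerivAt_apply [IsScalarTower ℝ 𝕜 E] [IsScalarTower ℝ 𝕜 F]
    {G : C0Group 𝕜 E} {x y : E} (h : G.IsGen x y) (l : E →L[𝕜] F) (t : ℝ) :
    HasDerivAt (fun t => l (G.op t x)) (l (G.op t y)) t :=
  (l.restrictScalars ℝ).hasFDerivAt.comp_hasDerivAt t (h.hasDerivAt t)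

theorem isGen_prodId_iff {G : C0Group 𝕜 E} {p q : E × F} :
    (G.prodId F).IsGen p q ↔ G.IsGen p.1 q.1 ∧ q.2 = 0 := by
  constructor
  · intro h
    have h1 := (ContinuousLinearMap.fst ℝ E F).hasFDerivAt.comp_hasDerivAt 0
      (show HasDerivAt _ _ _ from h)
    have h2 := (ContinuousLinearMap.snd ℝ E F).hasFDerivAt.comp_hasDerivAt 0
      (show HasDerivAt _ _ _ from h)
    exact ⟨h1, HasDerivAt.unique h2 (hasDerivAt_const (0 : ℝ) p.2)⟩
  · rintro ⟨h1, h2⟩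
    have := HasDerivAt.prodMk (show HasDerivAt _ _ _ from h1) (hasDerivAt_const (0 : ℝ) p.2)
    rw [← h2] at this
    exact this

end C0Group

/-! ### Restriction to the kernel, closedness and the Dirichlet operator -/

section Operators

variable {𝕜 X Y Z : Type*} [RCLike 𝕜] [NormedAddCommGroup X] [NormedSpace 𝕜 X]
  [NormedAddCommGroup Y] [NormedSpace 𝕜 Y] [NormedAddCommGroup Z] [NormedSpace 𝕜 Z]

theorem mem_reductionGraph_restrictKer_iff {ι : Y →L[𝕜] X} {A : Y →ₗ.[𝕜] X}
    {R : A.domain →ₗ[𝕜] Z} {p q : Y × X} :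
    (p, q) ∈ reductionGraph ι (restrictKer A R) ↔
      ∃ (w : A.domain) (v : Y), R w = 0 ∧ p = ((w : Y), ι v) ∧ q = (v, A w) := by
  have hdom : ∀ y : Y, y ∈ (restrictKer A R).domain ↔ ∃ w : A.domain, (w : Y) = y ∧ R w = 0 := by
    intro y
    change y ∈ (LinearMap.ker R).map A.domain.subtype ⊓ A.domain ↔ _
    simp only [Submodule.mem_inf, Submodule.mem_map, LinearMap.mem_ker, Submodule.subtype_apply]
    constructor
    · rintro ⟨⟨w, hw, rfl⟩, -⟩
      exact ⟨w, rfl, hw⟩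
    · rintro ⟨w, rfl, hw⟩
      exact ⟨⟨w, hw, rfl⟩, w.2⟩
  have happ : ∀ (u : (restrictKer A R).domain) (w : A.domain), (u : Y) = w →
      restrictKer A R u = A w := fun u w h => LinearPMap.domRestrict_apply h
  constructor
  · rintro ⟨u, v, h⟩
    obtain ⟨w, hw, hR⟩ := (hdom u).1 u.2
    rw [happ u w hw.symm] at h
    exact ⟨w, v, hR, by rw [hw]; exact congrArg Prod.fst h, congrArg Prod.snd h⟩
  · rintro ⟨w, v, hR, rfl, rfl⟩
    refine ⟨⟨w, (hdom w).2 ⟨w, rfl, hR⟩⟩, v, ?_⟩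
    rw [happ _ w rfl]

/-- Closedness of the stacked operator is stable under bounded perturbations of the second row. -/
theorem isClosed_stacked_add {A : Y →ₗ.[𝕜] X} {R : A.domain →ₗ[𝕜] Z}
    (h : (stacked A R).IsClosed) (B : Y →L[𝕜] Z) :
    (stacked A (R + restrictDomain A B)).IsClosed := by
  -- The perturbed graph is the preimage of the original one under this shear.
  have hc : Continuous fun p : Y × (X × Z) => (p.1, (p.2.1, p.2.2 - B p.1)) := by fun_prop
  have hpre := IsClosed.preimage hc h
  refine (congrArg IsClosed ?_).mp hpre
  ext ⟨y, x, z⟩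
  simp only [Set.mem_preimage, SetLike.mem_coe, LinearPMap.mem_graph_iff]
  constructor
  · rintro ⟨u, hu, hz⟩
    refine ⟨u, hu, ?_⟩
    have h1 : A u = x := congrArg Prod.fst hz
    have h2 : R u = z - B y := congrArg Prod.snd hz
    have hu' : (u : Y) = y := hu
    change (A u, R u + B u) = (x, z)
    rw [h1, h2, hu', sub_add_cancel]
  · rintro ⟨u, hu, hz⟩
    refine ⟨u, hu, ?_⟩
    have h1 : A u = x := congrArg Prod.fst hz
    have h2 : R u + B u = z := congrArg Prod.snd hz
    have hu' : (u : Y) = y := hu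
    change (A u, R u) = (x, z - B y)
    rw [h1, ← h2, ← hu', add_sub_cancel_right]

/-- The abstract Dirichlet operator: a bounded right inverse of `R` with values in
`ker (μ - A)`. -/
theorem exists_dirichlet [CompleteSpace Y] [CompleteSpace Z] {ι : Y →L[𝕜] X} {A : Y →ₗ.[𝕜] X}
    {R : A.domain →ₗ[𝕜] Z} (hcl : (stacked A R).IsClosed) (hsurj : Function.Surjective R) {μ : 𝕜}
    (hex : ∀ x : X, ∃ w : A.domain, R w = 0 ∧ μ • ι w - A w = x)
    (hinj : ∀ w : A.domain, R w = 0 → A w = μ • ι w → w = 0) :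
    ∃ D : Z →L[𝕜] Y, ∀ z, ∃ d : A.domain, (d : Y) = D z ∧ R d = z ∧ A d = μ • ι d := by
  let K : Submodule 𝕜 A.domain :=
    LinearMap.ker (A.toFun - μ • ((ι : Y →ₗ[𝕜] X) ∘ₗ A.domain.subtype))
  have hK : ∀ w, w ∈ K ↔ A w = μ • ι w := by
    intro w
    change A.toFun w - μ • ι w = 0 ↔ _
    rw [sub_eq_zero]; rfl
  -- For surjectivity, any preimage `u` of `z` is corrected by the `w ∈ ker R` with `(μ - A) w = (μ
  -- - A) u`.
  have hbij : Function.Bijective (R.domRestrict K) := by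
    constructor
    · rw [← LinearMap.ker_eq_bot, LinearMap.ker_eq_bot']
      intro w hw
      exact Subtype.ext (hinj w hw ((hK w).1 w.2))
    · intro z
      obtain ⟨u, hu⟩ := hsurj z
      obtain ⟨w, hw0, hw⟩ := hex (μ • ι u - A u)
      refine ⟨⟨u - w, (hK _).2 ?_⟩, ?_⟩
      · rw [LinearPMap.map_sub, Submodule.coe_sub, map_sub, smul_sub]
        rw [sub_eq_sub_iff_add_eq_add] at hw ⊢
        rw [add_comm, ← hw, add_comm]
      · change R (u - w) = z
        rw [map_sub, hu, hw0, sub_zero]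
  let e := LinearEquiv.ofBijective _ hbij
  let D₀ : Z →ₗ[𝕜] Y := A.domain.subtype ∘ₗ K.subtype ∘ₗ (e.symm : Z →ₗ[𝕜] K)
  have hD : ∀ z, ∃ d : A.domain, (d : Y) = D₀ z ∧ R d = z ∧ A d = μ • ι d := fun z =>
    ⟨(e.symm z : K), rfl, e.apply_symm_apply z, (hK _).1 (e.symm z).2⟩
  -- `y = D₀ z` holds exactly when `y` has image `(μ y, z)` under the stacked operator, so
  -- closedness passes to `D₀` and the closed graph theorem bounds it.
  have hgraph : IsClosed (D₀.graph : Set (Z × Y)) := by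
    have hc : Continuous fun p : Z × Y => (p.2, (μ • ι p.2, p.1)) := by fun_prop
    refine (congrArg IsClosed ?_).mp (IsClosed.preimage hc hcl)
    ext ⟨z, y⟩
    simp only [Set.mem_preimage, SetLike.mem_coe, LinearPMap.mem_graph_iff, LinearMap.mem_graph_iff]
    constructor
    · rintro ⟨(u : A.domain), hu, huz⟩
      have hu' : (u : Y) = y := hu
      have h1 : A u = μ • ι y := congrArg Prod.fst huz
      have h2 : R u = z := congrArg Prod.snd huz
      obtain ⟨d, hd, hRd, hAd⟩ := hD z
      have : u - d = 0 := hinj _ (by rw [map_sub, h2, hRd, sub_self]) (by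
        rw [LinearPMap.map_sub, Submodule.coe_sub, map_sub, smul_sub, h1, hAd, hu'])
      rw [← hd, ← hu', sub_eq_zero.1 this]
    · rintro rfl
      obtain ⟨d, hd, hRd, hAd⟩ := hD z
      exact ⟨d, hd, by rw [← hd, ← hAd]; exact Prod.ext rfl hRd⟩
  exact ⟨⟨D₀, D₀.continuous_of_isClosed_graph hgraph⟩, hD⟩

end Operators

/-! ### The group governing the boundary value problem -/

section StateGroup

variable {𝕜 X Y Z : Type*} [RCLike 𝕜]
  [NormedAddCommGroup X] [NormedSpace 𝕜 X] [CompleteSpace X] [NormedSpace ℝ X]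
  [IsScalarTower ℝ 𝕜 X]
  [NormedAddCommGroup Y] [NormedSpace 𝕜 Y] [CompleteSpace Y] [NormedSpace ℝ Y]
  [IsScalarTower ℝ 𝕜 Y]
  [NormedAddCommGroup Z] [NormedSpace 𝕜 Z] [CompleteSpace Z] [NormedSpace ℝ Z]
  [IsScalarTower ℝ 𝕜 Z]

/-- The reduction matrix generates a group as soon as it generates a semigroup. -/
theorem exists_group_of_reductionGraph {ι : Y →L[𝕜] X} {A₀ : Y →ₗ.[𝕜] X}
    {T : C0Semigroup 𝕜 (Y × X)} (hT : T.generatorGraph = reductionGraph ι A₀) :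
    ∃ G : C0Group 𝕜 (Y × X), ∀ p q, G.IsGen p q ↔ (p, q) ∈ reductionGraph ι A₀ := by
  rw [← hT]
  refine C0Semigroup.exists_group
    -- Velocity reversal: it sends `(u, v)` to `(u, -v)` and turns the reduction matrix into its
    -- negative.
    (J := (ContinuousLinearMap.id 𝕜 Y).prodMap (-ContinuousLinearMap.id 𝕜 X))
    (fun x => by ext <;> simp) fun x y h => ?_
  rw [hT] at h ⊢
  obtain ⟨u, v, h⟩ := h
  obtain ⟨rfl, rfl⟩ := Prod.mk.inj h
  exact ⟨u, -v, by simp⟩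

/-- The state `(u, v, x, y)` of the boundary value problem, with `y = R u`, in coordinates in which
the first component lies in `ker R`. -/
def stateOf (ι : Y →L[𝕜] X) (A : Y →ₗ.[𝕜] X) (R : A.domain →ₗ[𝕜] Z) (D : Z →L[𝕜] Y)
    (u : A.domain) (v : Y) (x : Z) : (Y × X) × (Z × Z) :=
  (((u : Y) - D (R u), ι v), (x, R u))

/-- The Dirichlet operator and the group that governs the boundary value problem. -/
theorem exists_state_group {ι : Y →L[𝕜] X} {A : Y →ₗ.[𝕜] X} {R L : A.domain →ₗ[𝕜] Z}
    {b₁ b₂ : Y →L[𝕜] Z} {b₃ b₄ : Z →L[𝕜] Z} (hL : ∀ u : A.domain, L u = R u + b₂ u)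
    (hcl : (stacked A R).IsClosed) (hsurj : Function.Surjective R)
    {T : C0Semigroup 𝕜 (Y × X)} (hT : T.generatorGraph = reductionGraph ι (restrictKer A R)) :
    ∃ (D : Z →L[𝕜] Y) (S : C0Group 𝕜 ((Y × X) × (Z × Z))),
      Dense {U | ∃ V, S.IsGen U V} ∧ ∀ U V, S.IsGen U V ↔ ∃ (u : A.domain) (v : Y) (x : Z),
        U = stateOf ι A R D u v x ∧
        V = ((v - D (b₁ u + b₃ x + b₄ (L u)), A u), (L u, b₁ u + b₃ x + b₄ (L u))) := by
  obtain ⟨G, hG⟩ := exists_group_of_reductionGraph hT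
  obtain ⟨l, hl, hl'⟩ := G.exists_real_resolvent
  have hμ : ∀ x : X, (((l * l : ℝ) : 𝕜)) • x = l • l • x := fun x => by
    rw [smul_smul]
    simpa using (algebraMap_smul 𝕜 (l * l) x)
  have hιl : ∀ y : Y, ι (l • y) = l • ι y := fun y => (ι.restrictScalars ℝ).map_smul l y
  -- Here `μ = l²`: the resolvent equation at `l` with right side `(0, x)` says `v = l w` and `l² w
  -- - A w = x`.
  obtain ⟨D, hD⟩ := exists_dirichlet (ι := ι) (μ := ((l * l : ℝ) : 𝕜)) hcl hsurj
    (fun x => by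
      obtain ⟨p, q, hpq, h⟩ := hl (0, x)
      obtain ⟨w, v, hw, rfl, rfl⟩ := mem_reductionGraph_restrictKer_iff.1 ((hG _ _).1 hpq)
      have h1 : l • (w : Y) - v = 0 := congrArg Prod.fst h
      have h2 : l • ι v - A w = x := congrArg Prod.snd h
      refine ⟨w, hw, ?_⟩
      rw [hμ, ← hιl, sub_eq_zero.1 h1, h2])
    (fun w hw hAw => by
      have : ((w : Y), ι (l • (w : Y))) = (0 : Y × X) := hl' _ ((hG _ _).2
        (mem_reductionGraph_restrictKer_iff.2 ⟨w, l • (w : Y), hw, rfl, by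
          rw [hAw, hμ, hιl]; rfl⟩))
      exact Subtype.ext (congrArg Prod.fst this))
  let uL : (Y × X) × (Z × Z) →L[𝕜] Y :=
    (ContinuousLinearMap.fst 𝕜 Y X).comp (ContinuousLinearMap.fst 𝕜 _ _) +
      D.comp ((ContinuousLinearMap.snd 𝕜 Z Z).comp (ContinuousLinearMap.snd 𝕜 _ _))
  let yL : (Y × X) × (Z × Z) →L[𝕜] Z :=
    (ContinuousLinearMap.snd 𝕜 Z Z).comp (ContinuousLinearMap.snd 𝕜 _ _)
  let xL : (Y × X) × (Z × Z) →L[𝕜] Z :=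
    (ContinuousLinearMap.fst 𝕜 Z Z).comp (ContinuousLinearMap.snd 𝕜 _ _)
  let lL := yL + b₂.comp uL
  let cL := b₁.comp uL + b₃.comp xL + b₄.comp lL
  -- What remains after the reduction matrix acts on `(w, v)`: with `u = w + D y`, the terms are `-D
  -- y'`, `μ D y`, `x' = L u` and `y'`. Here `lL` is `L u` and `cL` is `y'`.
  let P : (Y × X) × (Z × Z) →L[𝕜] (Y × X) × (Z × Z) :=
    ((-(D.comp cL)).prod (((l * l : ℝ) : 𝕜) • ι.comp (D.comp yL))).prod (lL.prod cL)
  obtain ⟨S, hS⟩ := (G.prodId (Z × Z)).exists_perturbation P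
  have hP : ∀ (w : Y) (v : X) (x y : Z) (u : A.domain), (u : Y) = w + D y → R u = y →
      P ((w, v), (x, y)) = ((-D (b₁ u + b₃ x + b₄ (L u)), ((l * l : ℝ) : 𝕜) • ι (D y)),
        (L u, b₁ u + b₃ x + b₄ (L u))) := by
    intro w v x y u hu hR
    have : L u = y + b₂ (w + D y) := by rw [hL, hR, hu]
    rw [this, hu]
    rfl
  have hgen : ∀ U V, S.IsGen U V ↔
      (∃ (w : A.domain) (v : Y), R w = 0 ∧ U.1 = ((w : Y), ι v) ∧ (V - P U).1 = (v, A w)) ∧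
        (V - P U).2 = 0 := by
    intro U V
    have := hS U (V - P U)
    rw [sub_add_cancel, C0Group.isGen_prodId_iff, hG, mem_reductionGraph_restrictKer_iff] at this
    exact this
  refine ⟨D, S, ?_, fun U V => ?_⟩
  · have h1 : Dense ({p | ∃ q, (p, q) ∈ T.generatorGraph} ×ˢ (Set.univ : Set (Z × Z))) :=
      T.dense_domain.prod dense_univ
    refine h1.mono ?_
    rintro ⟨p, z⟩ ⟨⟨q, hq⟩, -⟩
    rw [hT, ← hG] at hq
    exact ⟨(q, 0) + P (p, z), (hS _ _).2 (C0Group.isGen_prodId_iff.2 ⟨hq, rfl⟩)⟩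
  · rw [hgen]
    constructor
    · rintro ⟨⟨w, v, hw, hU, hV1⟩, hV2⟩
      obtain ⟨p, x, y⟩ := U
      obtain rfl : p = ((w : Y), ι v) := hU
      obtain ⟨d, hd, hRd, hAd⟩ := hD y
      have hu : ((w + d : A.domain) : Y) = w + D y := by rw [Submodule.coe_add, hd]
      have hR : R (w + d) = y := by rw [map_add, hw, hRd, zero_add]
      refine ⟨w + d, v, x, ?_, ?_⟩
      · rw [stateOf, hR, hu, add_sub_cancel_right]
      · have hPU := hP w (ι v) x y (w + d) hu hR
        have hV : V = ((v, A w), 0) + P (((w : Y), ι v), (x, y)) := by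
          rw [← sub_eq_iff_eq_add]
          exact Prod.ext hV1 hV2
        rw [hV, hPU, LinearPMap.map_add, hAd, hd]
        simp [sub_eq_add_neg]
    · rintro ⟨u, v, x, rfl, rfl⟩
      obtain ⟨d, hd, hRd, hAd⟩ := hD (R u)
      have hPU := hP ((u : Y) - D (R u)) (ι v) x (R u) u (by abel) rfl
      rw [stateOf, hPU]
      refine ⟨⟨u - d, v, by rw [map_sub, hRd, sub_self], by rw [Submodule.coe_sub, hd], ?_⟩, ?_⟩
      · rw [LinearPMap.map_sub, hAd, hd]
        simp only [map_add, Prod.mk_sub_mk]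
        refine Prod.ext ?_ rfl
        dsimp only
        abel
      · simp

end StateGroup

/-! ### Classical solutions as orbits -/

section WellPosedness

theorem contDiff_one_of_hasDerivAt {F : Type*} [NormedAddCommGroup F] [NormedSpace ℝ F]
    {f f' : ℝ → F} (h : ∀ t, HasDerivAt f (f' t) t) (hf' : Continuous f') : ContDiff ℝ 1 f := by
  rw [contDiff_one_iff_deriv, funext fun t => (h t).deriv]
  exact ⟨fun t => (h t).differentiableAt, hf'⟩

theorem contDiff_two_of_hasDerivAt {F : Type*} [NormedAddCommGroup F] [NormedSpace ℝ F]
    {f f' f'' : ℝ → F} (h : ∀ t, HasDerivAt f (f' t) t) (h' : ∀ t, HasDerivAt f' (f'' t) t)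
    (hf'' : Continuous f'') : ContDiff ℝ 2 f := by
  rw [show (2 : WithTop ℕ∞) = 1 + 1 by norm_num, contDiff_succ_iff_deriv,
    funext fun t => (h t).deriv]
  exact ⟨fun t => (h t).differentiableAt, by simp, contDiff_one_of_hasDerivAt h' hf''⟩

variable {𝕜 X Y Z : Type*} [RCLike 𝕜]
  [NormedAddCommGroup X] [NormedSpace 𝕜 X] [NormedSpace ℝ X] [IsScalarTower ℝ 𝕜 X]
  [NormedAddCommGroup Y] [NormedSpace 𝕜 Y] [NormedSpace ℝ Y] [IsScalarTower ℝ 𝕜 Y]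
  [NormedAddCommGroup Z] [NormedSpace 𝕜 Z] [NormedSpace ℝ Z] [IsScalarTower ℝ 𝕜 Z]
  {ι : Y →L[𝕜] X} {A : Y →ₗ.[𝕜] X} {R L : A.domain →ₗ[𝕜] Z}
  {b₁ b₂ : Y →L[𝕜] Z} {b₃ b₄ : Z →L[𝕜] Z} {D : Z →L[𝕜] Y}
  {S : C0Group 𝕜 ((Y × X) × (Z × Z))}

omit [NormedSpace ℝ X] [IsScalarTower ℝ 𝕜 X] [NormedSpace ℝ Y] [IsScalarTower ℝ 𝕜 Y]
  [NormedSpace ℝ Z] [IsScalarTower ℝ 𝕜 Z] in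
theorem stateOf_inj (hι : Function.Injective ι) {u u' : A.domain} {v v' : Y} {x x' : Z}
    (h : stateOf ι A R D u v x = stateOf ι A R D u' v' x') : u = u' ∧ v = v' ∧ x = x' := by
  have h1 : (u : Y) - D (R u) = u' - D (R u') := congrArg (fun p => p.1.1) h
  have h2 : ι v = ι v' := congrArg (fun p => p.1.2) h
  have h3 : x = x' := congrArg (fun p => p.2.1) h
  have h4 : R u = R u' := congrArg (fun p => p.2.2) h
  rw [h4, sub_left_inj] at h1
  exact ⟨Subtype.ext h1, hι h2, h3⟩

namespace IsClassicalSolution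

variable {f g : Y} {h j : Z} {u : ℝ → A.domain} {x : ℝ → Z}

omit [IsScalarTower ℝ 𝕜 X] [IsScalarTower ℝ 𝕜 Y] [IsScalarTower ℝ 𝕜 Z] in
theorem hasDerivAt_Y (hs : IsClassicalSolution ι A L b₁ b₂ b₃ b₄ f g h j u x) (t : ℝ) :
    HasDerivAt (fun s => (u s : Y)) (deriv (fun s => (u s : Y)) t) t :=
  (hs.contDiff_Y.differentiable (by norm_num) t).hasDerivAt

omit [IsScalarTower ℝ 𝕜 Z] in
theorem deriv_X (hs : IsClassicalSolution ι A L b₁ b₂ b₃ b₄ f g h j u x) :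
    deriv (fun s => ι (u s)) = fun t => ι (deriv (fun s => (u s : Y)) t) :=
  funext fun t =>
    ((ι.restrictScalars ℝ).hasFDerivAt.comp_hasDerivAt t (hs.hasDerivAt_Y t)).deriv

omit [IsScalarTower ℝ 𝕜 X] [IsScalarTower ℝ 𝕜 Y] [IsScalarTower ℝ 𝕜 Z] in
theorem deriv_boundary (hs : IsClassicalSolution ι A L b₁ b₂ b₃ b₄ f g h j u x) :
    deriv x = fun t => L (u t) :=
  funext fun t => (hs.coupling_eq t).deriv

variable [CompleteSpace X] [CompleteSpace Y] [CompleteSpace Z]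

/-- The state of a classical solution is an orbit of the governing group. -/
theorem stateOf_eq (hL : ∀ u : A.domain, L u = R u + b₂ u)
    (hS : ∀ U V, S.IsGen U V ↔ ∃ (u : A.domain) (v : Y) (x : Z), U = stateOf ι A R D u v x ∧
      V = ((v - D (b₁ u + b₃ x + b₄ (L u)), A u), (L u, b₁ u + b₃ x + b₄ (L u))))
    (hs : IsClassicalSolution ι A L b₁ b₂ b₃ b₄ f g h j u x) (t : ℝ) :
    stateOf ι A R D (u t) (deriv (fun s => (u s : Y)) t) (x t) =
      S.op t (stateOf ι A R D (u 0) (deriv (fun s => (u s : Y)) 0) (x 0)) := by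
  set v := deriv fun s => (u s : Y) with hv
  -- Subtracting `b₂ u` from `L u` cancels the velocity term of the boundary equation.
  have hR : ∀ t, HasDerivAt (fun s => R (u s)) (b₁ (u t) + b₃ (x t) + b₄ (L (u t))) t := by
    intro t
    have h1 : HasDerivAt (fun s => L (u s)) (b₁ (u t) + b₂ (v t) + b₃ (x t) + b₄ (L (u t))) t := by
      have := (hs.contDiff_L.differentiable (by norm_num) t).hasDerivAt
      rwa [← hs.deriv_boundary, hs.boundary_eq t, hs.deriv_boundary] at this
    have h2 := (b₂.restrictScalars ℝ).hasFDerivAt.comp_hasDerivAt t (hs.hasDerivAt_Y t)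
    refine ((h1.sub h2).congr_deriv ?_).congr_of_eventuallyEq (Eventually.of_forall fun s => ?_)
    · change _ - b₂ (v t) = _
      abel
    · simp [hL]
  have hX : ∀ t, HasDerivAt (fun s => ι (v s)) (A (u t)) t := by
    intro t
    have h1 := hs.contDiff_X
    rw [show (2 : WithTop ℕ∞) = 1 + 1 by norm_num, contDiff_succ_iff_deriv] at h1
    have := (h1.2.2.differentiable (by norm_num) t).hasDerivAt
    rwa [hs.interior_eq t, hs.deriv_X] at this
  refine C0Group.eq_op_of_hasDerivAt (U := fun t => stateOf ι A R D (u t) (v t) (x t))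
    (fun t => ?_) (fun t => (hS _ _).2 ⟨u t, v t, x t, rfl, rfl⟩) t
  exact (((hs.hasDerivAt_Y t).sub
    ((D.restrictScalars ℝ).hasFDerivAt.comp_hasDerivAt t (hR t))).prodMk (hX t)).prodMk
    ((hs.coupling_eq t).prodMk (hR t))

end IsClassicalSolution

/-- An orbit starting in the domain stays there, which provides `u`, `v` and `x` at each time.
Bounded operators recover these and their derivatives from the orbits of `U₀` and of its generator
image `V₀`; this gives all the regularity required. -/
theorem exists_isClassicalSolution (hι : Function.Injective ι)
    (hL : ∀ u : A.domain, L u = R u + b₂ u)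
    (hS : ∀ U V, S.IsGen U V ↔ ∃ (u : A.domain) (v : Y) (x : Z), U = stateOf ι A R D u v x ∧
      V = ((v - D (b₁ u + b₃ x + b₄ (L u)), A u), (L u, b₁ u + b₃ x + b₄ (L u))))
    (f : A.domain) (g : Y) (h : Z) :
    ∃ (u : ℝ → A.domain) (x : ℝ → Z),
      IsClassicalSolution ι A L b₁ b₂ b₃ b₄ (f : Y) g h (L f) u x := by
  obtain ⟨U₀, hU₀⟩ : ∃ U, U = stateOf ι A R D f g h := ⟨_, rfl⟩
  obtain ⟨V₀, hgen⟩ : ∃ V, S.IsGen U₀ V := ⟨_, (hS _ _).2 ⟨f, g, h, hU₀, rfl⟩⟩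
  choose u v x hU hV using fun t => (hS _ _).1 (hgen.op t)
  have hinit : stateOf ι A R D (u 0) (v 0) (x 0) = stateOf ι A R D f g h := by
    rw [← hU, ← hU₀, S.op_zero_apply]
  obtain ⟨hu0, hv0, hx0⟩ := stateOf_inj hι hinit
  let uL : (Y × X) × (Z × Z) →L[𝕜] Y :=
    (ContinuousLinearMap.fst 𝕜 Y X).comp (ContinuousLinearMap.fst 𝕜 _ _) +
      D.comp ((ContinuousLinearMap.snd 𝕜 Z Z).comp (ContinuousLinearMap.snd 𝕜 _ _))
  let vL : (Y × X) × (Z × Z) →L[𝕜] X :=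
    (ContinuousLinearMap.snd 𝕜 Y X).comp (ContinuousLinearMap.fst 𝕜 _ _)
  let xL : (Y × X) × (Z × Z) →L[𝕜] Z :=
    (ContinuousLinearMap.fst 𝕜 Z Z).comp (ContinuousLinearMap.snd 𝕜 _ _)
  let yL : (Y × X) × (Z × Z) →L[𝕜] Z :=
    (ContinuousLinearMap.snd 𝕜 Z Z).comp (ContinuousLinearMap.snd 𝕜 _ _)
  have hVc := S.continuous_orbit V₀
  have huU : ∀ t, uL (S.op t U₀) = u t := fun t => by
    rw [hU]; exact sub_add_cancel _ _
  have huV : ∀ t, uL (S.op t V₀) = v t := fun t => by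
    rw [hV]; exact sub_add_cancel _ _
  have hvU : ∀ t, vL (S.op t U₀) = ι (v t) := fun t => by rw [hU]; rfl
  have hvV : ∀ t, vL (S.op t V₀) = A (u t) := fun t => by rw [hV]; rfl
  have hxU : ∀ t, xL (S.op t U₀) = x t := fun t => by rw [hU]; rfl
  have hxV : ∀ t, xL (S.op t V₀) = L (u t) := fun t => by rw [hV]; rfl
  have hyU : ∀ t, yL (S.op t U₀) = R (u t) := fun t => by rw [hU]; rfl
  have hyV : ∀ t, yL (S.op t V₀) = b₁ (u t) + b₃ (x t) + b₄ (L (u t)) := fun t => by rw [hV]; rfl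
  have hdu : ∀ t, HasDerivAt (fun s => (u s : Y)) (v t) t := fun t => by
    simpa only [huU, huV] using hgen.hasDerivAt_apply uL t
  have hdv : ∀ t, HasDerivAt (fun s => ι (v s)) (A (u t)) t := fun t => by
    simpa only [hvU, hvV] using hgen.hasDerivAt_apply vL t
  have hdx : ∀ t, HasDerivAt x (L (u t)) t := fun t => by
    simpa only [hxU, hxV] using hgen.hasDerivAt_apply xL t
  have hvc : Continuous v := by
    simpa only [Function.comp_def, huV] using uL.continuous.comp hVc
  have hAc : Continuous fun t => A (u t) := by
    simpa only [Function.comp_def, hvV] using vL.continuous.comp hVc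
  have hdL : ∀ t, HasDerivAt (fun s => L (u s))
      (b₁ (u t) + b₂ (v t) + b₃ (x t) + b₄ (L (u t))) t := by
    intro t
    -- On the orbit `L u = y + b₂ u` is a bounded operator of the state, although `L` itself need
    -- not be bounded on `Y`.
    have h1 : HasDerivAt (fun s => (yL + b₂.comp uL) (S.op s U₀)) _ t :=
      hgen.hasDerivAt_apply (yL + b₂.comp uL) t
    simp only [add_apply, ContinuousLinearMap.comp_apply, huU, huV, hyU, hyV,
      ← hL] at h1
    exact h1.congr_deriv (by abel)
  have hLc : Continuous fun t => b₁ (u t) + b₂ (v t) + b₃ (x t) + b₄ (L (u t)) := by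
    have h1 : Continuous fun t => (u t : Y) := continuous_iff_continuousAt.2 fun t =>
      (hdu t).continuousAt
    have h2 : Continuous x := continuous_iff_continuousAt.2 fun t => (hdx t).continuousAt
    have h3 : Continuous fun t => L (u t) := continuous_iff_continuousAt.2 fun t =>
      (hdL t).continuousAt
    exact (((b₁.continuous.comp h1).add (b₂.continuous.comp hvc)).add (b₃.continuous.comp h2)).add
      (b₄.continuous.comp h3)
  have hdX : ∀ t, HasDerivAt (fun s => ι (u s)) (ι (v t)) t := fun t =>
    (ι.restrictScalars ℝ).hasFDerivAt.comp_hasDerivAt t (hdu t)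
  have ex : deriv x = fun t => L (u t) := funext fun t => (hdx t).deriv
  refine ⟨u, x, ⟨contDiff_two_of_hasDerivAt hdX hdv hAc, contDiff_one_of_hasDerivAt hdu hvc,
    contDiff_one_of_hasDerivAt hdL hLc, fun t => ?_, fun t => ?_, hdx, by rw [hu0], ?_, hx0, ?_⟩⟩
  · rw [funext fun s => (hdX s).deriv, (hdv t).deriv]
  · rw [ex, (hdL t).deriv, (hdu t).deriv]
  · rw [(hdu 0).deriv, hv0]
  · rw [(hdx 0).deriv, hu0]

end WellPosedness

/-! ### Well-posedness -/

theorem proposition5p3 {𝕜 : Type*} [RCLike 𝕜] {X Y Z : Type*}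
    [NormedAddCommGroup X] [NormedSpace 𝕜 X] [CompleteSpace X]
    [NormedSpace ℝ X] [IsScalarTower ℝ 𝕜 X]
    [NormedAddCommGroup Y] [NormedSpace 𝕜 Y] [CompleteSpace Y]
    [NormedSpace ℝ Y] [IsScalarTower ℝ 𝕜 Y]
    [NormedAddCommGroup Z] [NormedSpace 𝕜 Z] [CompleteSpace Z]
    [NormedSpace ℝ Z] [IsScalarTower ℝ 𝕜 Z]
    (ι : Y →L[𝕜] X) (hι : Function.Injective ι)
    (A : Y →ₗ.[𝕜] X) (R : A.domain →ₗ[𝕜] Z)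
    (B₁ B₂ : Y →L[𝕜] Z) (B₃ B₄ : Z →L[𝕜] Z)
    (hclosed : (stacked A R).IsClosed)
    (M : Z →ₗ.[𝕜] Z) (hM : M.IsClosed) (hM1 : (1 : 𝕜) ∈ resolventSetOf M)
    (L : A.domain →ₗ[𝕜] Z) (hL : L = R + restrictDomain A B₂)
    (R' : A.domain →ₗ[𝕜] Z) (hR' : R' = L - restrictDomain A ((resolventOf M 1).comp B₂))
    (hsurj : Function.Surjective R')
    (hcos : GeneratesCosineWithPhaseSpace ι (restrictKer A R')) :
    IsWellPosed ι A L ((resolventOf M 1).comp B₁) ((resolventOf M 1).comp B₂)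
      ((resolventOf M 1).comp B₃) ((resolventOf M 1).comp B₄) := by
  set Q := resolventOf M 1
  have hLR : ∀ u : A.domain, L u = R' u + (Q.comp B₂) u := fun u => by
    rw [hR']
    exact (sub_add_cancel _ _).symm
  have hcl : (stacked A R').IsClosed := by
    have : R' = R + restrictDomain A (B₂ - Q.comp B₂) := by
      rw [hR', hL]
      ext u
      exact add_sub_assoc _ _ _
    rw [this]
    exact isClosed_stacked_add hclosed _
  obtain ⟨-, T, hT⟩ := hcos
  obtain ⟨D, S, hdense, hS⟩ := exists_state_group (b₁ := Q.comp B₁) (b₃ := Q.comp B₃)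
    (b₄ := Q.comp B₄) hLR hcl hsurj hT
  refine ⟨?_, ?_, ?_⟩
  · let Φ : (Y × X) × (Z × Z) → Y × X × Z × Z := fun U =>
      (U.1.1 + D U.2.2, U.1.2, U.2.1, U.2.2 + (Q.comp B₂) (U.1.1 + D U.2.2))
    have hΦ : Continuous Φ := by fun_prop
    have hΦs : Function.Surjective Φ := by
      rintro ⟨y, x, z, z'⟩
      refine ⟨((y - D (z' - (Q.comp B₂) y), x), (z, z' - (Q.comp B₂) y)), ?_⟩
      simp [Φ]
    refine (hΦs.denseRange.dense_image hΦ hdense).mono ?_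
    rintro _ ⟨U, ⟨V, hUV⟩, rfl⟩
    obtain ⟨u, v, x, rfl, -⟩ := (hS _ _).1 hUV
    refine ⟨u, v, x, ?_⟩
    rw [hLR]
    simp [Φ, stateOf]
  · rintro f g h _ rfl
    obtain ⟨u, x, hs⟩ := exists_isClassicalSolution hι hLR hS f g h
    refine ⟨(u, x), hs, ?_⟩
    rintro ⟨u', x'⟩ (hs' : IsClassicalSolution _ _ _ _ _ _ _ _ _ _ _ u' x')
    have h0 : u' 0 = u 0 := Subtype.ext (hs'.init_u.trans hs.init_u.symm)
    have key : ∀ t, u' t = u t ∧ x' t = x t := by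
      intro t
      have h1 := hs'.stateOf_eq hLR hS t
      rw [h0, hs'.init_u', ← hs.init_u', hs'.init_x, ← hs.init_x, ← hs.stateOf_eq hLR hS t] at h1
      obtain ⟨a, -, b⟩ := stateOf_inj hι h1
      exact ⟨a, b⟩
    exact Prod.ext (funext fun t => (key t).1) (funext fun t => (key t).2)
  · intro τ
    obtain ⟨C, hC0, hC⟩ := exists_norm_le_of_isCompact S.continuous_orbit
      (isCompact_Icc (a := -τ) (b := τ))
    set b := ‖Q.comp B₂‖
    set d := ‖D‖
    -- The outer factors compare the state norm with the norms of the solution and of the data; `C`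
    -- bounds the group on `[-τ, τ]`.
    refine ⟨((1 + b) * (1 + d) + 3) * C * (1 + d + d * b + 3 + b), ?_⟩
    intro f g h j u x hs t ht
    have hfY : (u 0 : Y) = f := hs.init_u
    have hj : L (u 0) = j := by rw [← hs.init_x', hs.deriv_boundary]
    have hj' : R' (u 0) = j - (Q.comp B₂) f := by rw [← hj, ← hfY, hLR, add_sub_cancel_right]
    have hst := hs.stateOf_eq hLR hS t
    rw [hs.init_u', hs.init_x] at hst
    rw [hs.deriv_X, hs.deriv_boundary]
    dsimp only
    set v := deriv (fun s => (u s : Y)) t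
    set U := stateOf ι A R' D (u t) v (x t) with hU
    set U₀ := stateOf ι A R' D (u 0) g h with hU₀
    have hUn : ‖U‖ ≤ C * ‖U₀‖ := by
      rw [hst]
      exact (S.op t).le_of_opNorm_le (hC t (abs_le.1 ht)) _
    have n1 : ‖(u t : Y) - D (R' (u t))‖ ≤ ‖U‖ := (norm_fst_le U.1).trans (norm_fst_le U)
    have n2 : ‖ι v‖ ≤ ‖U‖ := (norm_snd_le U.1).trans (norm_fst_le U)
    have n3 : ‖x t‖ ≤ ‖U‖ := (norm_fst_le U.2).trans (norm_snd_le U)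
    have n4 : ‖R' (u t)‖ ≤ ‖U‖ := (norm_snd_le U.2).trans (norm_snd_le U)
    have n5 : ‖(u t : Y)‖ ≤ (1 + d) * ‖U‖ := by
      calc ‖(u t : Y)‖ = ‖((u t : Y) - D (R' (u t))) + D (R' (u t))‖ := by rw [sub_add_cancel]
        _ ≤ ‖U‖ + d * ‖U‖ := (norm_add_le _ _).trans
            (add_le_add n1 (D.le_of_opNorm_le_of_le le_rfl n4))
        _ = _ := by ring
    have n6 : ‖L (u t)‖ ≤ ‖U‖ + b * ((1 + d) * ‖U‖) := by
      rw [hLR]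
      exact (norm_add_le _ _).trans
        (add_le_add n4 ((Q.comp B₂).le_of_opNorm_le_of_le le_rfl n5))
    have m4 : ‖R' (u 0)‖ ≤ ‖j‖ + b * ‖f‖ := by
      rw [hj']
      exact (norm_sub_le _ _).trans (add_le_add le_rfl ((Q.comp B₂).le_opNorm f))
    have m1 : ‖f - D (R' (u 0))‖ ≤ ‖f‖ + d * (‖j‖ + b * ‖f‖) :=
      (norm_sub_le _ _).trans (add_le_add le_rfl (D.le_of_opNorm_le_of_le le_rfl m4))
    have hb : 0 ≤ b := norm_nonneg _
    have hd : 0 ≤ d := norm_nonneg _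
    set N := ‖f‖ + ‖ι g‖ + ‖h‖ + ‖j‖ with hN
    have a1 := norm_nonneg f
    have a2 := norm_nonneg (ι g)
    have a3 := norm_nonneg h
    have a4 := norm_nonneg j
    have k1 : ‖f‖ ≤ N := by linarith
    have k2 : ‖ι g‖ ≤ N := by linarith
    have k3 : ‖h‖ ≤ N := by linarith
    have k4 : ‖j‖ ≤ N := by linarith
    have hU₀n : ‖U₀‖ ≤ (1 + d + d * b + 3 + b) * N := by
      have hle : ‖U₀‖ ≤ ‖f - D (R' (u 0))‖ + ‖ι g‖ + ‖h‖ + ‖R' (u 0)‖ := by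
        rw [hU₀, stateOf, hfY, Prod.norm_mk, Prod.norm_mk, Prod.norm_mk]
        have p1 := norm_nonneg (f - D (R' (u 0)))
        have p2 := norm_nonneg (R' (u 0))
        refine max_le (max_le ?_ ?_) (max_le ?_ ?_) <;> linarith
      calc ‖U₀‖ ≤ (‖f‖ + d * (‖j‖ + b * ‖f‖)) + ‖ι g‖ + ‖h‖ + (‖j‖ + b * ‖f‖) := by linarith
        _ ≤ (N + d * (N + b * N)) + N + N + (N + b * N) := by gcongr
        _ = _ := by ring
    calc ‖(u t : Y)‖ + ‖ι v‖ + ‖x t‖ + ‖L (u t)‖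
        ≤ (1 + d) * ‖U‖ + ‖U‖ + ‖U‖ + (‖U‖ + b * ((1 + d) * ‖U‖)) := by linarith
      _ = ((1 + b) * (1 + d) + 3) * ‖U‖ := by ring
      _ ≤ ((1 + b) * (1 + d) + 3) * (C * ((1 + d + d * b + 3 + b) * N)) := by
          gcongr
          exact hUn.trans (by gcongr)
      _ = _ := by ring

end
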